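/- A partition is a finite, possibly empty, non-increasing sequence $\lambda=(\lambda_1,\dots,\lambda_k)$ of positive integers (its parts); its size is $\lambda_1+\dots+\lambda_k$. The hook length of a cell of its Young diagram is the number of cells to its right in the same row, plus the number of cells below it in the same column, plus one. A partition is an $(s,t)$-core if none of its hook lengths equals $s$ or $t$. **Theorem 1.** Let $n\ge 0$ be an integer. The set of $(2n+1,2n+3)$-core partitions with pairwise distinct parts is finite, it has exactly $4^n$ elements, and the average size of its elements is $$\frac{10n^3+27n^2+19n}{32}.$$ -/

import Mathlib

namespace YoungDiagram

/-- The hook length of the cell in row `i` and column `j` (both counted from `0`): the number of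
cells to its right in its row, plus the number of cells below it in its column, plus one.
For a cell of `μ` neither subtraction truncates. -/
def hookLength (μ : YoungDiagram) (i j : ℕ) : ℕ :=
  (μ.rowLen i - (j + 1)) + (μ.colLen j - (i + 1)) + 1

/-- A partition, given by its Young diagram, is an `s`-core if none of its hook lengths is `s`. -/
def IsCore (μ : YoungDiagram) (s : ℕ) : Prop :=
  ∀ i j : ℕ, (i, j) ∈ μ → μ.hookLength i j ≠ s

/-- The parts of the partition (the lengths of the nonempty rows) are pairwise distinct. -/
def HasDistinctParts (μ : YoungDiagram) : Prop :=
  μ.rowLens.Nodup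

end YoungDiagram

/-- The set of all `(s, t)`-core partitions with distinct parts, of any size. -/
def distinctCores (s t : ℕ) : Set YoungDiagram :=
  {μ | μ.IsCore s ∧ μ.IsCore t ∧ μ.HasDistinctParts}

/-! A partition is determined by the set S of hook lengths in its first column, which can be any
finite set of positive integers. It is an s-core iff S is closed under x ↦ x - s (for x ≥ s), its
parts are distinct iff S has no two consecutive elements, and its size is the sum of S minus |S|(|S|
- 1)/2.

Write x + 1 = q(2n+2) + c with 0 ≤ c < 2n+2. Subtracting 2n+1 or 2n+3 moves (q, c) to (q-1, c+1) or
(q-1, c-1), so S is an order ideal in a lattice that splits according to the parity of q + c. Since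
S has no consecutive elements, the two halves never compete, and a single ±1 walk w records both: in
column c the even half is cut at height w(c) and the odd half at -w(c). Going once around the strip
exchanges the halves, hence w(2n+2) = -w(0). The admissible S correspond exactly to such walks with
w(0) odd and positive (`IsGood.isDistinctCode`, `IsDistinctCode.exists_encodes`,
`IsGood.eq_of_inCode_iff`).

A walk with opposite ends is fixed by its up-steps, so there are 4^(n+1) of them. The antiperiodic
rotation exchanges odd and even starts, and negation exchanges positive and negative odd starts,
which leaves 4^n.

Eight times the size is a quadratic expression `sizeStat` in |w(c)|, w(c) and the signs of w at even
times (`IsGood.sizeStat_eq`). Reversal of the walk cancels the terms odd under it. The others reduce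
to the correlations of |w| and of sign w at two times, which depend only on the lag. The second
difference of |u| and the first difference of sign u are supported at 0. Hence the differences of
the correlations in the lag count walks returning to the origin, that is, they are products of
central binomial coefficients (`absCorr_secondDiff`, `signCorr_diff`). Summation by parts and two
convolution identities finish the computation (`sum_good_sizeStat`). -/

open Finset in
theorem sum_range_two_mul_even {M : Type*} [AddCommMonoid M] (f : ℕ → M) (N : ℕ) :
    ∑ c ∈ range (2 * N), (if Even c then f c else 0) = ∑ k ∈ range N, f (2 * k) := by
  induction N with
  | zero => simp
  | succ N ih =>
    rw [show 2 * (N + 1) = 2 * N + 1 + 1 by ring, sum_range_succ, sum_range_succ, ih,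
      sum_range_succ]
    simp

/-! ### Convolutions of central binomial coefficients. -/

namespace CentralConvolution

open Finset Nat

/-- The reflection i ↦ n - i fixes the product, so the weight i may be replaced by its average n/2.
-/
theorem sum_fst_mul (n : ℕ) (a : ℕ → ℤ) :
    2 * ∑ i ∈ range (n + 1), (i : ℤ) * (a i * a (n - i))
      = n * ∑ i ∈ range (n + 1), a i * a (n - i) := by
  have h := sum_range_reflect (fun i => (i : ℤ) * (a i * a (n - i))) (n + 1)
  rw [two_mul]
  nth_rewrite 1 [← h]
  rw [← sum_add_distrib, mul_sum]
  refine sum_congr rfl fun i hi => ?_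
  have hi' : i ≤ n := by simpa [Nat.lt_succ_iff] using hi
  simp only [Nat.add_sub_cancel, Nat.sub_sub_self hi', Nat.cast_sub hi']
  ring

/-- The convolution square of the central binomial coefficients. -/
theorem sum_centralBinom (n : ℕ) :
    ∑ i ∈ range (n + 1), (centralBinom i : ℤ) * centralBinom (n - i) = 4 ^ n := by
  induction n with
  | zero => simp
  | succ n ih =>
    have h1 := sum_fst_mul (n + 1) (fun i => (centralBinom i : ℤ))
    have h2 := sum_fst_mul n (fun i => (centralBinom i : ℤ))
    rw [sum_range_succ'] at h1
    -- The recurrence (k+1) C(k+1) = 2(2k+1) C(k), with C the central binomial coefficient, absorbs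
    -- the weight; `sum_fst_mul` then removes the remaining factor k, so the convolution is
    -- multiplied by 4 when n grows by one.
    have h3 : ∑ k ∈ range (n + 1), ((k + 1 : ℕ) : ℤ) *
          ((centralBinom (k + 1) : ℤ) * centralBinom (n + 1 - (k + 1)))
        = ∑ k ∈ range (n + 1), (4 * ((k : ℤ) * ((centralBinom k : ℤ) * centralBinom (n - k)))
          + 2 * ((centralBinom k : ℤ) * centralBinom (n - k))) := by
      refine sum_congr rfl fun k _ => ?_
      have := Nat.succ_mul_centralBinom_succ k
      have h : ((k : ℤ) + 1) * centralBinom (k + 1) = 2 * (2 * k + 1) * centralBinom k := by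
        exact_mod_cast this
      rw [Nat.add_sub_add_right]
      push_cast
      linear_combination (centralBinom (n - k) : ℤ) * h
    rw [h3, sum_add_distrib, ← mul_sum, ← mul_sum, ih] at h1
    rw [ih] at h2
    push_cast at h1
    have h5 : ((n : ℤ) + 1) ≠ 0 := by positivity
    apply mul_left_cancel₀ h5
    rw [← h1]
    rw [pow_succ]
    linear_combination 4 * h2

theorem sum_mul_centralBinom (n : ℕ) :
    8 * ∑ i ∈ range (n + 1), (i : ℤ) * (n - i) * (centralBinom i * centralBinom (n - i))
      = 4 ^ n * (n * (n - 1)) := by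
  induction n with
  | zero => simp
  | succ n ih =>
    have h2 := sum_fst_mul n (fun i => (centralBinom i : ℤ))
    rw [sum_centralBinom] at h2
    rw [sum_range_succ']
    have h3 : ∑ k ∈ range (n + 1), ((k + 1 : ℕ) : ℤ) * (((n + 1 : ℕ) : ℤ) - (k + 1 : ℕ)) *
          ((centralBinom (k + 1) : ℤ) * centralBinom (n + 1 - (k + 1)))
        = ∑ k ∈ range (n + 1),
          (4 * ((k : ℤ) * (n - k) * ((centralBinom k : ℤ) * centralBinom (n - k)))
          + (2 * n * ((centralBinom k : ℤ) * centralBinom (n - k))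
            - 2 * (k * ((centralBinom k : ℤ) * centralBinom (n - k))))) := by
      refine sum_congr rfl fun k _ => ?_
      have := Nat.succ_mul_centralBinom_succ k
      have h : ((k : ℤ) + 1) * centralBinom (k + 1) = 2 * (2 * k + 1) * centralBinom k := by
        exact_mod_cast this
      rw [Nat.add_sub_add_right]
      push_cast
      linear_combination ((n : ℤ) - k) * (centralBinom (n - k) : ℤ) * h
    rw [h3, sum_add_distrib, sum_sub_distrib, ← mul_sum, ← mul_sum, ← mul_sum, sum_centralBinom,
      pow_succ]
    push_cast
    linear_combination 4 * ih - 8 * h2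

/-- This is the form needed after summation by parts of the absolute value correlations: at the even
lag k = 2p the weight (k+1)(2n+1-k) is (2p+1)(2(n-p)+1). -/
theorem sum_odd_mul_centralBinom (n : ℕ) :
    2 * ∑ p ∈ range (n + 1), (2 * (p : ℤ) + 1) * (2 * (n - p) + 1) *
      (centralBinom p * centralBinom (n - p)) = 4 ^ n * ((n + 1) * (n + 2)) := by
  have h1 := sum_mul_centralBinom n
  have h2 := sum_centralBinom n
  have : ∑ p ∈ range (n + 1), (2 * (p : ℤ) + 1) * (2 * (n - p) + 1) *
      (centralBinom p * centralBinom (n - p))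
      = 4 * ∑ i ∈ range (n + 1), (i : ℤ) * (n - i) * (centralBinom i * centralBinom (n - i))
        + (2 * n + 1) * ∑ i ∈ range (n + 1), (centralBinom i : ℤ) * centralBinom (n - i) := by
    rw [mul_sum, mul_sum, ← sum_add_distrib]
    exact sum_congr rfl fun k _ => by ring
  rw [this]
  linear_combination h1 + (2 * (2 * (n : ℤ) + 1)) * h2

end CentralConvolution

/-! ### Summation by parts. -/

section SecondDifference

open Finset

theorem sum_succ_mul_secondDiff (f : ℕ → ℤ) (M : ℕ) :
    ∑ k ∈ range M, ((k : ℤ) + 1) * (f (k + 2) - 2 * f (k + 1) + f k)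
      = M * f (M + 1) - (M + 1) * f M + f 0 := by
  induction M with
  | zero => simp
  | succ M ih => rw [sum_range_succ, ih]; push_cast; ring

/-- Summation by parts against the second difference. -/
theorem two_mul_sum_eq_secondDiff (f : ℕ → ℤ) (M : ℕ) :
    2 * ∑ k ∈ range (M + 2), f k = (M + 2) * (f 0 + f (M + 1))
      - ∑ k ∈ range M, ((k : ℤ) + 1) * (M - k) * (f (k + 2) - 2 * f (k + 1) + f k) := by
  induction M with
  | zero => simp [sum_range_succ]
  | succ M ih =>
    have h := sum_succ_mul_secondDiff f (M + 1)
    have h2 : ∑ k ∈ range (M + 1), ((k : ℤ) + 1) * ((M + 1 : ℕ) - k) *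
          (f (k + 2) - 2 * f (k + 1) + f k)
        = ∑ k ∈ range M, ((k : ℤ) + 1) * (M - k) * (f (k + 2) - 2 * f (k + 1) + f k)
          + ∑ k ∈ range (M + 1), ((k : ℤ) + 1) * (f (k + 2) - 2 * f (k + 1) + f k) := by
      rw [sum_range_succ, sum_range_succ _ M, ← add_assoc, ← sum_add_distrib]
      push_cast
      congr 1
      · exact sum_congr rfl fun k _ => by ring
      · ring
    rw [h2, h, sum_range_succ, mul_add, ih]
    push_cast
    ring

end SecondDifference

/-! ### Walks with opposite ends and their joint distribution at two times. -/

namespace SignWalk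

open Finset

/-- The step `±1` at `i` of the walk whose up-steps are the elements of `E`. -/
def step (E : Finset ℕ) (i : ℕ) : ℤ := if i ∈ E then 1 else -1

/-- The walk of length `2 * n + 2` with up-steps `E`, started so that its two ends are opposite. -/
def walk (n : ℕ) (E : Finset ℕ) (c : ℕ) : ℤ := (n + 1) - #E + ∑ i ∈ range c, step E i

theorem sum_step {m : ℕ} {E : Finset ℕ} (hE : E ⊆ range m) :
    ∑ i ∈ range m, step E i = 2 * #E - m := by
  unfold step
  rw [sum_ite, filter_mem_eq_inter, inter_eq_right.2 hE, filter_notMem_eq_sdiff]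
  simp [card_sdiff_of_subset hE, Nat.cast_sub (card_le_card hE |>.trans_eq (card_range m))]
  ring

theorem walk_succ (n : ℕ) (E : Finset ℕ) (c : ℕ) : walk n E (c + 1) = walk n E c + step E c := by
  simp [walk, sum_range_succ, add_assoc]

theorem walk_end {n : ℕ} {E : Finset ℕ} (hE : E ⊆ range (2 * n + 2)) :
    walk n E (2 * n + 2) = - walk n E 0 := by
  rw [walk, sum_step hE, walk]; push_cast; simp; ring

/-- The start is minus half the total of all steps. Doubling therefore gives the steps before c
minus the steps from c on, a signed sum over all steps with no constant term. -/
theorem two_walk {n : ℕ} {E : Finset ℕ} (hE : E ⊆ range (2 * n + 2)) {c : ℕ}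
    (hc : c ≤ 2 * n + 2) :
    2 * walk n E c = ∑ i ∈ range (2 * n + 2), (if i < c then 1 else -1) * step E i := by
  have h : ∑ i ∈ range (2 * n + 2), (if i < c then (1 : ℤ) else -1) * step E i
      = 2 * ∑ i ∈ range c, step E i - ∑ i ∈ range (2 * n + 2), step E i := by
    have hr : range c = {i ∈ range (2 * n + 2) | i < c} := by
      ext i
      simp only [mem_range, mem_filter]
      omega
    rw [hr, sum_filter, mul_sum, ← sum_sub_distrib]
    refine sum_congr rfl fun i _ => ?_
    split_ifs <;> ring
  rw [h, sum_step hE, walk]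
  push_cast
  ring

/-! ### Transfer operators -/

/-- Sum over a joint step `±1` of both coordinates. -/
def diagOp (F : ℤ → ℤ → ℤ) (u v : ℤ) : ℤ := F (u + 1) (v + 1) + F (u - 1) (v - 1)

/-- Sum over opposite steps `±1` of the two coordinates. -/
def antiOp (F : ℤ → ℤ → ℤ) (u v : ℤ) : ℤ := F (u + 1) (v - 1) + F (u - 1) (v + 1)

theorem commute_diagOp_antiOp : Function.Commute diagOp antiOp := by
  intro F
  funext u v
  simp only [diagOp, antiOp, add_sub_cancel_right, sub_add_cancel]
  ring

theorem sum_powerset_range_succ (m : ℕ) (f : Finset ℕ → ℤ) :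
    ∑ E ∈ (range (m + 1)).powerset, f E
      = ∑ E ∈ (range m).powerset, (f E + f (insert m E)) := by
  rw [range_add_one, sum_powerset_insert (by simp), sum_add_distrib]

/-- Summation over all sign patterns of a function of two signed sums is an iterate of the transfer
operators. -/
theorem sum_powerset_signed (α β : ℕ → ℤ) (hα : ∀ i, α i = 1 ∨ α i = -1)
    (hβ : ∀ i, β i = 1 ∨ β i = -1) (m : ℕ) (F : ℤ → ℤ → ℤ) (u v : ℤ) :
    ∑ E ∈ (range m).powerset,
        F (u + ∑ i ∈ range m, α i * step E i) (v + ∑ i ∈ range m, β i * step E i)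
      = diagOp^[#{i ∈ range m | α i = β i}] (antiOp^[#{i ∈ range m | α i ≠ β i}] F) u v := by
  induction m generalizing F with
  | zero => simp
  | succ m ih =>
    rw [sum_powerset_range_succ]
    have key : ∀ E ∈ (range m).powerset,
        F (u + ∑ i ∈ range (m + 1), α i * step E i) (v + ∑ i ∈ range (m + 1), β i * step E i)
        + F (u + ∑ i ∈ range (m + 1), α i * step (insert m E) i)
            (v + ∑ i ∈ range (m + 1), β i * step (insert m E) i)
        = (if α m = β m then diagOp F else antiOp F)
            (u + ∑ i ∈ range m, α i * step E i) (v + ∑ i ∈ range m, β i * step E i) := by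
      intro E hE
      have hm : m ∉ E := fun h => by simpa using mem_powerset.1 hE h
      have h1 : step E m = -1 := by simp [step, hm]
      have h2 : step (insert m E) m = 1 := by simp [step]
      have h3 : ∀ γ : ℕ → ℤ, ∑ i ∈ range m, γ i * step (insert m E) i
          = ∑ i ∈ range m, γ i * step E i := fun γ => sum_congr rfl fun i hi => by
        have : i ≠ m := (mem_range.1 hi).ne
        simp [step, this]
      simp only [sum_range_succ, h1, h2, h3, ← add_assoc]
      generalize u + ∑ i ∈ range m, α i * step E i = x
      generalize v + ∑ i ∈ range m, β i * step E i = y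
      rcases hα m with ha | ha <;> rcases hβ m with hb | hb <;>
        simp [ha, hb, diagOp, antiOp, sub_eq_add_neg, add_comm]
    rw [sum_congr rfl key, ih, range_add_one, filter_insert, filter_insert]
    by_cases h : α m = β m
    · rw [if_pos h, if_pos h, if_neg (by simpa using h), card_insert_of_notMem (by simp),
        Function.iterate_succ_apply]
      rw [(commute_diagOp_antiOp.iterate_right _).eq]
    · rw [if_neg h, if_neg h, if_pos h, card_insert_of_notMem (by simp),
        Function.iterate_succ_apply]

/-- The signs in 2w(c) and 2w(c+k) disagree exactly at the k steps between the two times. Hence the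
joint distribution depends on the lag k only. -/
theorem sum_walk_pair (n c k : ℕ) (h : c + k ≤ 2 * n + 2) (F : ℤ → ℤ → ℤ) :
    ∑ E ∈ (range (2 * n + 2)).powerset, F (2 * walk n E c) (2 * walk n E (c + k))
      = diagOp^[2 * n + 2 - k] (antiOp^[k] F) 0 0 := by
  have h1 := sum_powerset_signed (fun i => if i < c then 1 else -1)
    (fun i => if i < c + k then 1 else -1) (fun i => by split_ifs <;> simp)
    (fun i => by split_ifs <;> simp) (2 * n + 2) F 0 0
  have h2 : {i ∈ range (2 * n + 2) | (if i < c then (1 : ℤ) else -1) ≠ if i < c + k then 1 else -1}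
      = Ico c (c + k) := by
    ext i
    simp only [mem_filter, mem_range, mem_Ico]
    split_ifs <;> simp <;> omega
  have h3 := card_filter_add_card_filter_not (s := range (2 * n + 2))
    (fun i => (if i < c then (1 : ℤ) else -1) = if i < c + k then 1 else -1)
  have h4 : #{i ∈ range (2 * n + 2) |
      (if i < c then (1 : ℤ) else -1) ≠ if i < c + k then 1 else -1} = k := by
    rw [h2]; simp
  have h5 : #{i ∈ range (2 * n + 2) |
      (if i < c then (1 : ℤ) else -1) = if i < c + k then 1 else -1} = 2 * n + 2 - k := by
    simp only [ne_eq, card_range] at h3 h4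
    omega
  rw [h4, h5] at h1
  rw [← h1]
  refine sum_congr rfl fun E hE => ?_
  rw [two_walk (mem_powerset.1 hE) (by omega), two_walk (mem_powerset.1 hE) (by omega), zero_add,
    zero_add]

theorem diagOp_iterate (k : ℕ) (F : ℤ → ℤ → ℤ) (u v : ℤ) :
    diagOp^[k] F u v = ∑ i ∈ range (k + 1), (k.choose i : ℤ) * F (u + (2 * i - k)) (v + (2 * i - k)) := by
  induction k generalizing F with
  | zero => simp
  | succ k ih =>
    rw [Function.iterate_succ_apply, ih]
    have := Finset.sum_choose_succ_mul (R := ℤ) (fun i _ => F (u + (2 * i - (k + 1 : ℕ))) (v + (2 * i - (k + 1 : ℕ)))) k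
    rw [this, ← sum_add_distrib]
    refine sum_congr rfl fun i _ => ?_
    rw [diagOp, ← mul_add, add_comm]
    push_cast
    ring_nf

theorem antiOp_iterate (k : ℕ) (F : ℤ → ℤ → ℤ) (u v : ℤ) :
    antiOp^[k] F u v = ∑ i ∈ range (k + 1), (k.choose i : ℤ) * F (u + (2 * i - k)) (v - (2 * i - k)) := by
  induction k generalizing F with
  | zero => simp
  | succ k ih =>
    rw [Function.iterate_succ_apply, ih]
    have := Finset.sum_choose_succ_mul (R := ℤ) (fun i _ => F (u + (2 * i - (k + 1 : ℕ))) (v - (2 * i - (k + 1 : ℕ)))) k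
    rw [this, ← sum_add_distrib]
    refine sum_congr rfl fun i _ => ?_
    rw [antiOp, ← mul_add, add_comm]
    push_cast
    ring_nf

/-- The number of `±1` sequences of length `k` with sum zero. -/
def returns (k : ℕ) : ℤ := ∑ i ∈ range (k + 1), (k.choose i : ℤ) * (if 2 * i = k then 1 else 0)

theorem returns_two_mul (p : ℕ) : returns (2 * p) = Nat.centralBinom p := by
  rw [returns, sum_eq_single p]
  · simp [Nat.centralBinom]
  · intro i _ hi
    simp [hi]
  · intro h
    simp at h
    omega

theorem returns_two_mul_add_one (p : ℕ) : returns (2 * p + 1) = 0 := by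
  refine sum_eq_zero fun i _ => ?_
  rw [if_neg (by omega), mul_zero]

/-- The indicator of the origin. -/
def origin (u v : ℤ) : ℤ := if u = 0 ∧ v = 0 then 1 else 0

/-- If the diagonal steps add up to x and the opposite steps to y, the endpoint is (x + y, x - y),
which is the origin iff x = y = 0. The count therefore factors. -/
theorem diagOp_antiOp_origin (k l : ℕ) :
    diagOp^[k] (antiOp^[l] origin) 0 0 = returns k * returns l := by
  rw [diagOp_iterate, returns, returns, sum_mul_sum]
  refine sum_congr rfl fun i _ => ?_
  rw [antiOp_iterate, mul_sum]
  refine sum_congr rfl fun j _ => ?_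
  have : origin (0 + (2 * (i : ℤ) - k) + (2 * j - l)) (0 + (2 * (i : ℤ) - k) - (2 * j - l))
      = (if 2 * i = k then 1 else 0) * (if 2 * j = l then 1 else 0) := by
    unfold origin
    by_cases h1 : 2 * i = k <;> by_cases h2 : 2 * j = l <;> simp [h1, h2] <;> omega
  rw [this]; ring

end SignWalk

/-! ### Correlations as functions of the lag. -/

namespace SignWalk

open Finset

theorem diagOp_antiOp_iterate (k l : ℕ) (F : ℤ → ℤ → ℤ) :
    diagOp^[k] (antiOp^[l] F) 0 0 = ∑ i ∈ range (k + 1), ∑ j ∈ range (l + 1),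
      (k.choose i : ℤ) * ((l.choose j : ℤ) *
        F (0 + (2 * i - k) + (2 * j - l)) (0 + (2 * i - k) - (2 * j - l))) := by
  rw [diagOp_iterate]
  refine sum_congr rfl fun i _ => ?_
  rw [antiOp_iterate, mul_sum]

theorem diagOp_antiOp_const_mul (k l : ℕ) (a : ℤ) (F : ℤ → ℤ → ℤ) :
    diagOp^[k] (antiOp^[l] fun u v => a * F u v) 0 0 = a * diagOp^[k] (antiOp^[l] F) 0 0 := by
  simp only [diagOp_antiOp_iterate, mul_sum]
  exact sum_congr rfl fun i _ => sum_congr rfl fun j _ => by ring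

theorem diagOp_antiOp_sub (k l : ℕ) (F G : ℤ → ℤ → ℤ) :
    diagOp^[k] (antiOp^[l] fun u v => F u v - G u v) 0 0
      = diagOp^[k] (antiOp^[l] F) 0 0 - diagOp^[k] (antiOp^[l] G) 0 0 := by
  simp only [diagOp_antiOp_iterate, ← sum_sub_distrib]
  exact sum_congr rfl fun i _ => sum_congr rfl fun j _ => by ring

theorem diagOp_succ_antiOp (k l : ℕ) (F : ℤ → ℤ → ℤ) :
    diagOp^[k + 1] (antiOp^[l] F) = diagOp^[k] (antiOp^[l] (diagOp F)) := by
  rw [Function.iterate_succ_apply, (commute_diagOp_antiOp.iterate_right l).eq]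

theorem diagOp_antiOp_succ (k l : ℕ) (F : ℤ → ℤ → ℤ) :
    diagOp^[k] (antiOp^[l + 1] F) = diagOp^[k] (antiOp^[l] (antiOp F)) := by
  rw [Function.iterate_succ_apply]

/-! ### Correlations of absolute values -/

/-- The absolute value, cut off at odd integers. -/
def evenAbs (u : ℤ) : ℤ := if u % 2 = 0 then |u| else 0

theorem evenAbs_two_mul (x : ℤ) : evenAbs (2 * x) = 2 * |x| := by
  simp [evenAbs, abs_mul]

/-- Without the cut-off, the second difference of step 2 would also be nonzero at u = ±1. Only even
arguments 2w(c) occur, so the cut-off costs nothing. -/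
theorem evenAbs_secondDiff (u : ℤ) :
    evenAbs (u + 2) - 2 * evenAbs u + evenAbs (u - 2) = if u = 0 then 4 else 0 := by
  unfold evenAbs
  rcases Int.emod_two_eq_zero_or_one u with h | h
  · rw [if_pos (by omega), if_pos h, if_pos (by omega)]
    rcases abs_cases (u + 2) with ⟨h1, _⟩ | ⟨h1, _⟩ <;> rcases abs_cases u with ⟨h2, _⟩ | ⟨h2, _⟩ <;>
      rcases abs_cases (u - 2) with ⟨h3, _⟩ | ⟨h3, _⟩ <;> rw [h1, h2, h3] <;> split_ifs <;> omega
  · rw [if_neg (by omega), if_neg (by omega), if_neg (by omega), if_neg (by omega)]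
    rfl

/-- The sum over all walks of `4 * |w c| * |w (c + k)|`, which does not depend on `c`. -/
def absCorr (n k : ℕ) : ℤ :=
  diagOp^[2 * n + 2 - k] (antiOp^[k] fun u v => evenAbs u * evenAbs v) 0 0

theorem sum_abs_mul_abs {n c k : ℕ} (h : c + k ≤ 2 * n + 2) :
    ∑ E ∈ (range (2 * n + 2)).powerset, 4 * (|walk n E c| * |walk n E (c + k)|)
      = absCorr n k := by
  rw [absCorr, ← sum_walk_pair n c k h]
  refine sum_congr rfl fun E _ => ?_
  rw [evenAbs_two_mul, evenAbs_two_mul]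
  ring

/-- Raising the lag by one trades a `diagOp` for an `antiOp`, and these commute, so the second
difference in the lag inserts (antiOp - diagOp)^2. On a product f(u)f(v) this square is the product
of the second differences of f in u and in v, here 4 · 4 times the indicator of the origin. -/
theorem absCorr_secondDiff {n k : ℕ} (h : k ≤ 2 * n) :
    absCorr n (k + 2) - 2 * absCorr n (k + 1) + absCorr n k
      = 16 * (returns (2 * n - k) * returns k) := by
  obtain ⟨N, hN⟩ := Nat.exists_eq_add_of_le h
  have e0 : 2 * n + 2 - k = N + 1 + 1 := by omega
  have e1 : 2 * n + 2 - (k + 1) = N + 1 := by omega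
  have e2 : 2 * n + 2 - (k + 2) = N := by omega
  have e3 : 2 * n - k = N := by omega
  simp only [absCorr, e0, e1, e2, e3]
  set φ : ℤ → ℤ → ℤ := fun u v => evenAbs u * evenAbs v with hφ
  rw [diagOp_succ_antiOp, diagOp_succ_antiOp, diagOp_succ_antiOp, diagOp_antiOp_succ,
    diagOp_antiOp_succ, diagOp_antiOp_succ,
    ← diagOp_antiOp_origin, ← diagOp_antiOp_const_mul, ← diagOp_antiOp_const_mul]
  have key : (fun u v => 16 * origin u v)
      = fun u v => (fun u v => antiOp (antiOp φ) u v - 2 * antiOp (diagOp φ) u v) u v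
          - (-1) * diagOp (diagOp φ) u v := by
    funext u v
    have h1 := evenAbs_secondDiff u
    have h2 := evenAbs_secondDiff v
    have h3 : 16 * origin u v = (if u = 0 then 4 else 0) * (if v = 0 then 4 else 0) := by
      unfold origin
      split_ifs <;> simp_all
    rw [h3, ← h1, ← h2]
    simp only [antiOp, diagOp, hφ]
    ring_nf
  rw [key, diagOp_antiOp_sub, diagOp_antiOp_sub]
  rw [diagOp_antiOp_const_mul N k (-1)]
  ring

/-- The linear terms in (u+1)(v+1) + (u-1)(v-1) cancel: one diagonal step doubles the function and
raises the constant by 1. -/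
theorem diagOp_iterate_mul (k : ℕ) (a : ℤ) :
    diagOp^[k] (fun u v => u * v + a) 0 0 = 2 ^ k * (a + k) := by
  induction k generalizing a with
  | zero => simp
  | succ k ih =>
    have : diagOp (fun u v => u * v + a) = fun u v => 2 * (u * v + (a + 1)) := by
      funext u v
      simp only [diagOp]
      ring
    have h2 := diagOp_antiOp_const_mul k 0 2 (fun u v => u * v + (a + 1))
    simp only [Function.iterate_zero, id] at h2
    rw [Function.iterate_succ_apply, this, h2, ih]
    push_cast
    ring

theorem sum_walk_sq {n c : ℕ} (h : c ≤ 2 * n + 2) :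
    ∑ E ∈ (range (2 * n + 2)).powerset, 4 * walk n E c ^ 2 = (2 * (n : ℤ) + 2) * 2 ^ (2 * n + 2) := by
  have h1 := sum_walk_pair n c 0 h (fun u v => u * v + 0)
  have h2 := diagOp_iterate_mul (2 * n + 2) 0
  rw [Nat.sub_zero, Function.iterate_zero, id, h2] at h1
  push_cast at h1
  rw [mul_comm (2 ^ _), zero_add] at h1
  rw [← h1]
  exact sum_congr rfl fun E _ => by rw [Nat.add_zero]; ring

theorem absCorr_zero (n : ℕ) : absCorr n 0 = (2 * n + 2) * 2 ^ (2 * n + 2) := by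
  rw [← sum_abs_mul_abs (c := 0) (k := 0) (by omega), ← sum_walk_sq (c := 0) (by omega)]
  refine sum_congr rfl fun E _ => ?_
  rw [Nat.add_zero, abs_mul_abs_self, sq]

/-- Since the ends are opposite, |w| closes up with period 2n+2, and a pair of times at lag k is
also a pair at lag 2n+2-k. -/
theorem absCorr_symm {n k : ℕ} (h : k ≤ 2 * n + 2) :
    absCorr n (2 * n + 2 - k) = absCorr n k := by
  rw [← sum_abs_mul_abs (c := 0) (k := k) (by omega),
    ← sum_abs_mul_abs (c := k) (k := 2 * n + 2 - k) (by omega)]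
  refine sum_congr rfl fun E hE => ?_
  rw [Nat.add_sub_cancel' h, walk_end (mem_powerset.1 hE), abs_neg, zero_add]
  ring

theorem sum_mul_returns (n : ℕ) :
    ∑ k ∈ range (2 * n + 1), ((k : ℤ) + 1) * ((2 * n + 1 : ℕ) - k) *
        (16 * (returns (2 * n - k) * returns k))
      = 8 * (4 ^ n * ((n + 1) * (n + 2))) := by
  have h := CentralConvolution.sum_odd_mul_centralBinom n
  have h1 := sum_range_two_mul_even (fun k : ℕ => ((k : ℤ) + 1) * ((2 * n + 1 : ℕ) - k) *
        (16 * (returns (2 * n - k) * returns k))) (n + 1)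
  rw [show 2 * (n + 1) = 2 * n + 1 + 1 by ring, sum_range_succ,
    if_neg (by simp [parity_simps]), add_zero] at h1
  rw [← h, mul_sum, mul_sum]
  trans ∑ c ∈ range (2 * n + 1), if Even c then ((c : ℤ) + 1) * ((2 * n + 1 : ℕ) - c) *
        (16 * (returns (2 * n - c) * returns c)) else 0
  · refine sum_congr rfl fun k _ => ?_
    split_ifs with hk
    · rfl
    · obtain ⟨j, rfl⟩ := Nat.not_even_iff_odd.1 hk
      simp [returns_two_mul_add_one]
  · rw [h1]
    refine sum_congr rfl fun p hp => ?_
    have hp' : p ≤ n := by simpa [Nat.lt_succ_iff] using hp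
    rw [← Nat.mul_sub, returns_two_mul, returns_two_mul]
    push_cast
    ring

/-- By summation by parts, only the two equal end values, given by the second moment, and the
weighted second differences enter. -/
theorem sum_absCorr (n : ℕ) :
    ∑ k ∈ range (2 * n + 2), absCorr n k = 4 ^ (n + 1) * (3 * (n + 1) ^ 2 - (n + 1)) := by
  have h := two_mul_sum_eq_secondDiff (absCorr n) (2 * n + 1)
  have h1 : ∑ k ∈ range (2 * n + 1), ((k : ℤ) + 1) * ((2 * n + 1 : ℕ) - k) *
        (absCorr n (k + 2) - 2 * absCorr n (k + 1) + absCorr n k)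
      = 8 * (4 ^ n * ((n + 1) * (n + 2))) := by
    rw [← sum_mul_returns]
    refine sum_congr rfl fun k hk => ?_
    rw [absCorr_secondDiff (by simpa [Nat.lt_succ_iff] using hk)]
  rw [h1, sum_range_succ, show 2 * n + 1 + 1 = 2 * n + 2 from rfl] at h
  have h2 := absCorr_symm (n := n) (k := 0) (by omega)
  rw [Nat.sub_zero] at h2
  rw [h2, absCorr_zero] at h
  have h3 : (2 : ℤ) ^ (2 * n + 2) = 4 ^ n * 4 := by
    rw [pow_add, pow_mul]; norm_num
  rw [h3] at h
  rw [pow_succ]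
  push_cast at h
  linarith

/-! ### Correlations of signs -/

/-- The sign, cut off outside the residue class of `2` modulo `4`. -/
def oddSign (u : ℤ) : ℤ := if u % 4 = 2 then u.sign else 0

theorem oddSign_two_mul (x : ℤ) : oddSign (2 * x) = if Odd x then x.sign else 0 := by
  unfold oddSign
  by_cases h : Odd x
  · rw [if_pos (by have := Int.odd_iff.1 h; omega), if_pos h, Int.sign_mul, show Int.sign 2 = 1 from rfl, one_mul]
  · rw [if_neg (by have := mt Int.odd_iff.2 h; omega), if_neg h]

/-- When 4 divides u, both arguments lie in the retained class and differ in sign only at u = 0;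
otherwise both values are cut off. The uncut sign would have further nonzero differences, for
example at u = ±2, where sign 0 enters. -/
theorem oddSign_diff (u : ℤ) : oddSign (u + 2) - oddSign (u - 2) = if u = 0 then 2 else 0 := by
  unfold oddSign
  by_cases h : u % 4 = 0
  · rw [if_pos (by omega), if_pos (by omega)]
    rcases lt_trichotomy u 0 with h1 | h1 | h1
    · rw [Int.sign_eq_neg_one_of_neg (by omega), Int.sign_eq_neg_one_of_neg (by omega),
        if_neg (by omega)]; rfl
    · subst h1; rfl
    · rw [Int.sign_eq_one_of_pos (by omega), Int.sign_eq_one_of_pos (by omega),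
        if_neg (by omega)]; rfl
  · rw [if_neg (by omega), if_neg (by omega), if_neg (by omega)]; rfl

/-- The sum over all walks with `w (2 * i)` odd of `sign (w (2 * i)) * sign (w (2 * (i + k)))`. -/
def signCorr (n k : ℕ) : ℤ :=
  diagOp^[2 * n + 2 - 2 * k] (antiOp^[2 * k] fun u v => oddSign u * oddSign v) 0 0

theorem sum_oddSign_mul {n i k : ℕ} (h : i + k ≤ n + 1) :
    ∑ E ∈ (range (2 * n + 2)).powerset,
      oddSign (2 * walk n E (2 * i)) * oddSign (2 * walk n E (2 * (i + k))) = signCorr n k := by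
  rw [signCorr, ← sum_walk_pair n (2 * i) (2 * k) (by omega), mul_add]

/-- Raising k by one replaces diagOp² by antiOp². On a product g(u)g(v), the difference diagOp² -
antiOp² is (g(u+2) - g(u-2))(g(v+2) - g(v-2)), here 2 · 2 times the indicator of the origin. -/
theorem signCorr_diff {n k : ℕ} (h : k ≤ n) :
    signCorr n k - signCorr n (k + 1) = 4 * (Nat.centralBinom k * Nat.centralBinom (n - k)) := by
  obtain ⟨N, rfl⟩ := Nat.exists_eq_add_of_le h
  have e0 : 2 * (k + N) + 2 - 2 * k = 2 * N + 1 + 1 := by omega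
  have e1 : 2 * (k + N) + 2 - 2 * (k + 1) = 2 * N := by omega
  have e2 : k + N - k = N := by omega
  simp only [signCorr, e0, e1, e2]
  rw [diagOp_succ_antiOp, diagOp_succ_antiOp,
    show 2 * (k + 1) = 2 * k + 1 + 1 from rfl, diagOp_antiOp_succ, diagOp_antiOp_succ,
    ← diagOp_antiOp_sub, ← returns_two_mul, ← returns_two_mul, mul_comm (returns _),
    ← diagOp_antiOp_origin, ← diagOp_antiOp_const_mul]
  refine congrArg (fun F => diagOp^[2 * N] (antiOp^[2 * k] F) 0 0) (funext fun u => funext fun v => ?_)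
  have h1 := oddSign_diff u
  have h2 := oddSign_diff v
  have h3 : 4 * origin u v = (if u = 0 then 2 else 0) * (if v = 0 then 2 else 0) := by
    unfold origin
    split_ifs <;> simp_all
  rw [h3, ← h1, ← h2]
  simp only [antiOp, diagOp]
  ring_nf

theorem signCorr_symm {n k : ℕ} (h : k ≤ n + 1) : signCorr n (n + 1 - k) = - signCorr n k := by
  rw [← sum_oddSign_mul (i := 0) (k := k) (by omega),
    ← sum_oddSign_mul (i := k) (k := n + 1 - k) (by omega), ← sum_neg_distrib]
  refine sum_congr rfl fun E hE => ?_
  have : ∀ u, oddSign (-u) = - oddSign u := fun u => by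
    unfold oddSign
    by_cases h : u % 4 = 2
    · rw [if_pos (by omega), if_pos h, Int.sign_neg]
    · rw [if_neg (by omega), if_neg h, neg_zero]
  rw [Nat.add_sub_cancel' h, show 2 * (n + 1) = 2 * n + 2 by ring, walk_end (mem_powerset.1 hE),
    mul_neg, this, zero_add, mul_zero]
  ring

/-- The differences telescope to 4 times a central binomial convolution, and antisymmetry makes the
last value the negative of the first. -/
theorem signCorr_zero (n : ℕ) : signCorr n 0 = 2 * 4 ^ n := by
  have h := sum_range_sub' (signCorr n) (n + 1)
  have h1 := signCorr_symm (n := n) (k := 0) (by omega)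
  rw [Nat.sub_zero] at h1
  have h2 : ∑ k ∈ range (n + 1), (signCorr n k - signCorr n (k + 1)) = 4 * 4 ^ n := by
    rw [← CentralConvolution.sum_centralBinom, mul_sum]
    refine sum_congr rfl fun k hk => signCorr_diff (by simpa [Nat.lt_succ_iff] using hk)
  rw [h2, h1] at h
  linarith

/-- Summation by parts of the sign correlations against a linear weight. -/
theorem sum_mul_signCorr (n : ℕ) :
    2 * ∑ k ∈ range n, ((n : ℤ) - 1 - 2 * k) * signCorr n (k + 1) = 4 ^ n * (n * (n - 1)) := by
  have parts : ∀ K : ℕ, ∑ k ∈ range K, ((n : ℤ) - 1 - 2 * k) * signCorr n (k + 1)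
      = K * (n - K) * signCorr n K
        - ∑ k ∈ range K, ((k : ℤ) * (n - k)) * (signCorr n (k + 1) - signCorr n k) := by
    intro K
    induction K with
    | zero => simp
    | succ K ih =>
      rw [sum_range_succ, ih, sum_range_succ]
      push_cast
      ring
  have h := CentralConvolution.sum_mul_centralBinom n
  rw [sum_range_succ, sub_self, mul_zero, zero_mul, add_zero] at h
  rw [parts n, sub_self, mul_zero, zero_mul, zero_sub, ← h, mul_neg, ← mul_neg, ← sum_neg_distrib,
    mul_sum, mul_sum]
  refine sum_congr rfl fun k hk => ?_
  have := signCorr_diff (n := n) (k := k) (by simpa using (mem_range.1 hk).le)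
  linear_combination (2 * (k : ℤ) * (n - k)) * this

end SignWalk

/-! ### Double sums depending on the distance of the indices. -/

section DistSum

open Finset

theorem sum_dist (f : ℕ → ℤ) (N : ℕ) :
    ∑ i ∈ range N, ∑ j ∈ range N, f (Nat.dist i j)
      = N * f 0 + 2 * ∑ d ∈ range N, ((N : ℤ) - 1 - d) * f (d + 1) := by
  induction N with
  | zero => simp
  | succ N ih =>
    have h1 : ∑ i ∈ range N, f (Nat.dist i N) = ∑ d ∈ range N, f (d + 1) := by
      rw [← sum_range_reflect]
      refine sum_congr rfl fun i hi => ?_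
      have := mem_range.1 hi
      congr 1
      rw [Nat.dist_eq_sub_of_le (by omega)]
      omega
    have h2 : ∑ j ∈ range N, f (Nat.dist N j) = ∑ d ∈ range N, f (d + 1) := by
      rw [← h1]
      exact sum_congr rfl fun i _ => by rw [Nat.dist_comm]
    simp only [sum_range_succ, sum_add_distrib]
    rw [ih, h1, h2, Nat.dist_self]
    have h3 : ∑ d ∈ range N, (((N + 1 : ℕ) : ℤ) - 1 - d) * f (d + 1)
        = ∑ d ∈ range N, ((N : ℤ) - 1 - d) * f (d + 1) + ∑ d ∈ range N, f (d + 1) := by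
      rw [← sum_add_distrib]
      exact sum_congr rfl fun d _ => by push_cast; ring
    rw [h3]
    push_cast
    ring

/-- Pair the distance k with N+1-k: together they occur for 2(N+1) ordered pairs, independently of
k. -/
theorem sum_dist_of_symm (f : ℕ → ℤ) (N : ℕ) (h : ∀ k ≤ N + 1, f (N + 1 - k) = f k) :
    ∑ i ∈ range (N + 1), ∑ j ∈ range (N + 1), f (Nat.dist i j)
      = (N + 1) * ∑ k ∈ range (N + 1), f k := by
  have h1 : ∑ d ∈ range N, ((N : ℤ) - d) * f (d + 1) = ∑ d ∈ range N, ((d : ℤ) + 1) * f (d + 1) := by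
    rw [← sum_range_reflect]
    refine sum_congr rfl fun d hd => ?_
    have hd' := mem_range.1 hd
    rw [show N - 1 - d + 1 = N + 1 - (d + 1) by omega, h _ (by omega), Nat.sub_sub,
      Nat.cast_sub (by omega)]
    push_cast
    ring
  have h2 : ∑ d ∈ range N, ((N : ℤ) - d) * f (d + 1) + ∑ d ∈ range N, ((d : ℤ) + 1) * f (d + 1)
      = (N + 1) * ∑ d ∈ range N, f (d + 1) := by
    rw [← sum_add_distrib, mul_sum]
    exact sum_congr rfl fun d _ => by ring
  rw [sum_dist, sum_range_succ, sum_range_succ' (fun k => f k)]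
  have h3 : ∑ d ∈ range N, (((N + 1 : ℕ) : ℤ) - 1 - d) * f (d + 1)
      = ∑ d ∈ range N, ((N : ℤ) - d) * f (d + 1) :=
    sum_congr rfl fun d _ => by push_cast; ring
  rw [h3]
  push_cast
  linear_combination h2 + h1

theorem sum_dist_of_antisymm (f : ℕ → ℤ) (N : ℕ) (h : ∀ k ≤ N + 1, f (N + 1 - k) = - f k) :
    ∑ i ∈ range N, ∑ j ∈ range N, f (Nat.dist i j)
      = N * f 0 + ∑ d ∈ range N, ((N : ℤ) - 1 - 2 * d) * f (d + 1) := by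
  have h1 : ∑ d ∈ range N, ((N : ℤ) - 1 - d) * f (d + 1) = - ∑ d ∈ range N, (d : ℤ) * f (d + 1) := by
    rw [← sum_range_reflect, ← sum_neg_distrib]
    refine sum_congr rfl fun d hd => ?_
    have hd' := mem_range.1 hd
    rw [show N - 1 - d + 1 = N + 1 - (d + 1) by omega, h _ (by omega), Nat.sub_sub,
      Nat.cast_sub (by omega)]
    push_cast
    ring
  have h2 : ∑ d ∈ range N, ((N : ℤ) - 1 - 2 * d) * f (d + 1)
      = ∑ d ∈ range N, ((N : ℤ) - 1 - d) * f (d + 1) - ∑ d ∈ range N, (d : ℤ) * f (d + 1) := by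
    rw [← sum_sub_distrib]
    exact sum_congr rfl fun d _ => by ring
  rw [sum_dist, h2]
  linear_combination h1

end DistSum

/-! ### Symmetries acting on the set of walks. -/

namespace SignWalk

open Finset

/-- `w` makes steps `±1` on `[0, 2 * n + 2]` and its two end values are opposite. -/
structure IsWalk (n : ℕ) (w : ℕ → ℤ) : Prop where
  step_eq : ∀ c < 2 * n + 2, w (c + 1) = w c + 1 ∨ w (c + 1) = w c - 1
  end_eq : w (2 * n + 2) = - w 0

/-- The set of up-steps. -/
def upSteps (n : ℕ) (w : ℕ → ℤ) : Finset ℕ := {i ∈ range (2 * n + 2) | w i < w (i + 1)}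

theorem isWalk_walk {n : ℕ} {E : Finset ℕ} (hE : E ⊆ range (2 * n + 2)) : IsWalk n (walk n E) where
  step_eq c _ := by
    rw [walk_succ, step]
    split_ifs
    · exact Or.inl rfl
    · exact Or.inr rfl
  end_eq := walk_end hE

theorem upSteps_subset (n : ℕ) (w : ℕ → ℤ) : upSteps n w ⊆ range (2 * n + 2) := filter_subset _ _

theorem upSteps_congr {n : ℕ} {w w' : ℕ → ℤ} (h : ∀ c ≤ 2 * n + 2, w c = w' c) :
    upSteps n w = upSteps n w' := by
  refine filter_congr fun i hi => ?_
  have := mem_range.1 hi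
  rw [h i (by omega), h (i + 1) (by omega)]

theorem upSteps_walk {n : ℕ} {E : Finset ℕ} (hE : E ⊆ range (2 * n + 2)) :
    upSteps n (walk n E) = E := by
  ext i
  simp only [upSteps, mem_filter, walk_succ, step]
  constructor
  · rintro ⟨_, h⟩
    by_contra hi
    simp [hi] at h
  · intro hi
    exact ⟨hE hi, by simp [hi]⟩

theorem walk_upSteps {n : ℕ} {w : ℕ → ℤ} (hw : IsWalk n w) {c : ℕ} (hc : c ≤ 2 * n + 2) :
    walk n (upSteps n w) c = w c := by
  have h1 : ∀ i < 2 * n + 2, step (upSteps n w) i = w (i + 1) - w i := by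
    intro i hi
    simp only [step, upSteps, mem_filter, mem_range, hi, true_and]
    rcases hw.step_eq i hi with h | h
    · rw [if_pos (by omega)]; omega
    · rw [if_neg (by omega)]; omega
  have h2 : ∀ c ≤ 2 * n + 2, ∑ i ∈ range c, step (upSteps n w) i = w c - w 0 := fun c hc => by
    rw [← sum_range_sub]
    exact sum_congr rfl fun i hi => h1 i (by have := mem_range.1 hi; omega)
  have h3 := sum_step (upSteps_subset n w)
  rw [h2 _ le_rfl, hw.end_eq] at h3
  rw [walk, h2 c hc]
  push_cast at h3
  omega

theorem IsWalk.parity {n : ℕ} {w : ℕ → ℤ} (hw : IsWalk n w) {c : ℕ} (hc : c ≤ 2 * n + 2) :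
    (w c - w 0 - c) % 2 = 0 := by
  induction c with
  | zero => simp
  | succ c ih =>
    have := ih (by omega)
    rcases hw.step_eq c (by omega) with h | h <;> rw [h] <;> push_cast <;> omega

/-- Reindexing the sum over all walks along an invertible transformation. -/
theorem sum_comp_transform {n : ℕ} (T T' : (ℕ → ℤ) → ℕ → ℤ)
    (hT : ∀ w, IsWalk n w → IsWalk n (T w)) (hT' : ∀ w, IsWalk n w → IsWalk n (T' w))
    (cT : ∀ w w', (∀ c ≤ 2 * n + 2, w c = w' c) → ∀ c ≤ 2 * n + 2, T w c = T w' c)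
    (cT' : ∀ w w', (∀ c ≤ 2 * n + 2, w c = w' c) → ∀ c ≤ 2 * n + 2, T' w c = T' w' c)
    (inv : ∀ w, IsWalk n w → ∀ c ≤ 2 * n + 2, T' (T w) c = w c)
    (inv' : ∀ w, IsWalk n w → ∀ c ≤ 2 * n + 2, T (T' w) c = w c)
    (F : (ℕ → ℤ) → ℤ) (hF : ∀ w w', (∀ c ≤ 2 * n + 2, w c = w' c) → F w = F w') :
    ∑ E ∈ (range (2 * n + 2)).powerset, F (T (walk n E))
      = ∑ E ∈ (range (2 * n + 2)).powerset, F (walk n E) := by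
  refine sum_nbij' (fun E => upSteps n (T (walk n E))) (fun E => upSteps n (T' (walk n E)))
    (fun E _ => mem_powerset.2 (upSteps_subset _ _)) (fun E _ => mem_powerset.2 (upSteps_subset _ _))
    (fun E hE => ?_) (fun E hE => ?_) (fun E hE => ?_)
  · have hE' := mem_powerset.1 hE
    have hw := isWalk_walk hE'
    rw [upSteps_congr (w' := walk n E), upSteps_walk hE']
    intro c hc
    rw [cT' _ (T (walk n E)) (fun c hc => walk_upSteps (hT _ hw) hc) c hc, inv _ hw c hc]
  · have hE' := mem_powerset.1 hE
    have hw := isWalk_walk hE'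
    rw [upSteps_congr (w' := walk n E), upSteps_walk hE']
    intro c hc
    rw [cT _ (T' (walk n E)) (fun c hc => walk_upSteps (hT' _ hw) hc) c hc, inv' _ hw c hc]
  · have hw := isWalk_walk (mem_powerset.1 hE)
    exact (hF _ _ fun c hc => walk_upSteps (hT _ hw) hc).symm

theorem sum_neg (n : ℕ) (F : (ℕ → ℤ) → ℤ)
    (hF : ∀ w w', (∀ c ≤ 2 * n + 2, w c = w' c) → F w = F w') :
    ∑ E ∈ (range (2 * n + 2)).powerset, F (fun c => - walk n E c)
      = ∑ E ∈ (range (2 * n + 2)).powerset, F (walk n E) := by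
  have h : ∀ w, IsWalk n w → IsWalk n (fun c => - w c) := fun w hw =>
    ⟨fun c hc => by have := hw.step_eq c hc; omega, by rw [hw.end_eq]⟩
  have hc : ∀ w w' : ℕ → ℤ, (∀ c ≤ 2 * n + 2, w c = w' c) → ∀ c ≤ 2 * n + 2, - w c = - w' c :=
    fun w w' h c hc => by rw [h c hc]
  exact sum_comp_transform (fun w c => - w c) (fun w c => - w c) h h hc hc
    (fun w _ c _ => neg_neg _) (fun w _ c _ => neg_neg _) F hF

theorem sum_reverse (n : ℕ) (F : (ℕ → ℤ) → ℤ)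
    (hF : ∀ w w', (∀ c ≤ 2 * n + 2, w c = w' c) → F w = F w') :
    ∑ E ∈ (range (2 * n + 2)).powerset, F (fun c => - walk n E (2 * n + 2 - c))
      = ∑ E ∈ (range (2 * n + 2)).powerset, F (walk n E) := by
  have h : ∀ w, IsWalk n w → IsWalk n (fun c => - w (2 * n + 2 - c)) := fun w hw =>
    ⟨fun c hc => by
      have := hw.step_eq (2 * n + 2 - (c + 1)) (by omega)
      rw [show 2 * n + 2 - (c + 1) + 1 = 2 * n + 2 - c by omega] at this
      omega, by
      rw [Nat.sub_self, Nat.sub_zero, hw.end_eq, neg_neg]⟩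
  have hc : ∀ w w' : ℕ → ℤ, (∀ c ≤ 2 * n + 2, w c = w' c) →
      ∀ c ≤ 2 * n + 2, - w (2 * n + 2 - c) = - w' (2 * n + 2 - c) :=
    fun w w' h c _ => by rw [h _ (by omega)]
  have hi : ∀ w : ℕ → ℤ, ∀ c ≤ 2 * n + 2, - - w (2 * n + 2 - (2 * n + 2 - c)) = w c :=
    fun w c hc => by rw [neg_neg, Nat.sub_sub_self hc]
  exact sum_comp_transform (fun w c => - w (2 * n + 2 - c)) (fun w c => - w (2 * n + 2 - c)) h h hc hc
    (fun w _ => hi w) (fun w _ => hi w) F hF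

/-- The shift by one of the antiperiodic extension w(c+2n+2) = -w(c). Its inverse prepends -w(2n+1).
-/
theorem sum_rotate (n : ℕ) (F : (ℕ → ℤ) → ℤ)
    (hF : ∀ w w', (∀ c ≤ 2 * n + 2, w c = w' c) → F w = F w') :
    ∑ E ∈ (range (2 * n + 2)).powerset,
        F (fun c => if c < 2 * n + 2 then walk n E (c + 1) else - walk n E 1)
      = ∑ E ∈ (range (2 * n + 2)).powerset, F (walk n E) := by
  refine sum_comp_transform (fun w c => if c < 2 * n + 2 then w (c + 1) else - w 1)
    (fun w c => if c = 0 then - w (2 * n + 1) else w (c - 1)) (fun w hw => ⟨fun c hc => ?_, ?_⟩)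
    (fun w hw => ⟨fun c hc => ?_, ?_⟩) (fun w w' h c hc => ?_) (fun w w' h c hc => ?_)
    (fun w hw c hc => ?_) (fun w hw c hc => ?_) F hF
  · rw [if_pos hc]
    by_cases h : c + 1 < 2 * n + 2
    · rw [if_pos h]
      exact hw.step_eq _ h
    · rw [if_neg h, show c + 1 = 2 * n + 2 by omega, hw.end_eq]
      have := hw.step_eq 0 (by omega)
      rw [zero_add] at this
      omega
  · simp
  · rw [if_neg (by omega), Nat.add_sub_cancel]
    by_cases h : c = 0
    · subst h
      rw [if_pos rfl]
      have := hw.step_eq (2 * n + 1) (by omega)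
      rw [hw.end_eq] at this
      omega
    · rw [if_neg h]
      have := hw.step_eq (c - 1) (by omega)
      rwa [Nat.sub_add_cancel (by omega)] at this
  · rw [if_neg (by omega), if_pos rfl, neg_neg]
    rfl
  · split_ifs
    · exact h _ (by omega)
    · rw [h _ (by omega)]
  · split_ifs
    · rw [h _ (by omega)]
    · exact h _ (by omega)
  · by_cases h : c = 0
    · rw [if_pos h]; dsimp only; rw [if_pos (by omega), h, hw.end_eq, neg_neg]
    · rw [if_neg h]; dsimp only; rw [if_pos (by omega), Nat.sub_add_cancel (by omega)]
  · by_cases h : c < 2 * n + 2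
    · rw [if_pos h, if_neg (by omega), Nat.add_sub_cancel]
    · rw [if_neg h, if_neg one_ne_zero, show c = 2 * n + 2 by omega, hw.end_eq]

end SignWalk

/-! ### The size statistic and its total over good walks. -/

namespace SignWalk

open Finset

/-! ### Statistics of a walk -/

def absSum (n : ℕ) (w : ℕ → ℤ) : ℤ := ∑ c ∈ range (2 * n + 2), |w c|

def sqSum (n : ℕ) (w : ℕ → ℤ) : ℤ := ∑ c ∈ range (2 * n + 2), w c ^ 2

def absMoment (n : ℕ) (w : ℕ → ℤ) : ℤ :=
  ∑ c ∈ range (2 * n + 2), (((c : ℤ) - (n + 1)) * |w c| + (n + 1) * w c)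

def evenSign (n : ℕ) (w : ℕ → ℤ) : ℤ := ∑ k ∈ range n, (w (2 * (k + 1))).sign

def evenSignMoment (n : ℕ) (w : ℕ → ℤ) : ℤ :=
  ∑ k ∈ range n, (2 * (k : ℤ) + 1 - n) * (w (2 * (k + 1))).sign

/-- Eight times the size of the core partition encoded by a walk. -/
def sizeStat (n : ℕ) (w : ℕ → ℤ) : ℤ :=
  4 * (n + 1) * sqSum n w + 4 * absMoment n w + 4 * evenSignMoment n w - absSum n w ^ 2
    - evenSign n w ^ 2 - 2 * absSum n w * evenSign n w - 4 * (n + 1) + 1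

theorem absSum_congr {n : ℕ} {w w' : ℕ → ℤ}
    (h : ∀ c ≤ 2 * n + 2, w c = w' c) : absSum n w = absSum n w' :=
  sum_congr rfl fun c hc => by rw [h c (by have := mem_range.1 hc; omega)]

theorem sqSum_congr {n : ℕ} {w w' : ℕ → ℤ}
    (h : ∀ c ≤ 2 * n + 2, w c = w' c) : sqSum n w = sqSum n w' :=
  sum_congr rfl fun c hc => by rw [h c (by have := mem_range.1 hc; omega)]

theorem absMoment_congr {n : ℕ} {w w' : ℕ → ℤ}
    (h : ∀ c ≤ 2 * n + 2, w c = w' c) : absMoment n w = absMoment n w' :=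
  sum_congr rfl fun c hc => by rw [h c (by have := mem_range.1 hc; omega)]

theorem evenSign_congr {n : ℕ} {w w' : ℕ → ℤ}
    (h : ∀ c ≤ 2 * n + 2, w c = w' c) : evenSign n w = evenSign n w' :=
  sum_congr rfl fun c hc => by rw [h _ (by have := mem_range.1 hc; omega)]

theorem evenSignMoment_congr {n : ℕ} {w w' : ℕ → ℤ}
    (h : ∀ c ≤ 2 * n + 2, w c = w' c) : evenSignMoment n w = evenSignMoment n w' :=
  sum_congr rfl fun c hc => by rw [h _ (by have := mem_range.1 hc; omega)]

/-- The up-step sets of the walks with odd positive starting value. -/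
def good (n : ℕ) : Finset (Finset ℕ) :=
  {E ∈ (range (2 * n + 2)).powerset | Odd (walk n E 0) ∧ 0 < walk n E 0}

/-! ### Symmetries -/

theorem absSum_reverse {n : ℕ} {w : ℕ → ℤ} (hw : w (2 * n + 2) = - w 0) :
    absSum n (fun c => - w (2 * n + 2 - c)) = absSum n w := by
  unfold absSum
  rw [sum_range_succ' _ (2 * n + 1), sum_range_succ' _ (2 * n + 1), ← sum_range_reflect]
  dsimp only
  rw [Nat.sub_zero, hw, neg_neg]
  congr 1
  refine sum_congr rfl fun j hj => ?_
  have := mem_range.1 hj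
  rw [abs_neg, show 2 * n + 2 - (2 * n + 1 - 1 - j + 1) = j + 1 by omega]

/-- The centred weight c - (n+1) is odd under c ↦ 2n+2-c, and so is the linear term because the
reversed walk is also negated. The term c = 0 has no mirror image in the range, but it vanishes
since w(0) > 0. -/
theorem absMoment_reverse {n : ℕ} {w : ℕ → ℤ} (hw : w (2 * n + 2) = - w 0) (h0 : 0 < w 0) :
    absMoment n (fun c => - w (2 * n + 2 - c)) = - absMoment n w := by
  unfold absMoment
  rw [sum_range_succ' _ (2 * n + 1), sum_range_succ' _ (2 * n + 1), ← sum_range_reflect]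
  dsimp only
  rw [Nat.sub_zero, hw, neg_neg,
    abs_of_pos h0, neg_add, ← sum_neg_distrib]
  congr 1
  · refine sum_congr rfl fun j hj => ?_
    have := mem_range.1 hj
    rw [abs_neg, show 2 * n + 2 - (2 * n + 1 - 1 - j + 1) = j + 1 by omega,
      show 2 * n + 1 - 1 - j + 1 = 2 * n + 1 - j by omega, Nat.cast_sub (by omega)]
    push_cast
    ring
  · push_cast
    ring

theorem evenSign_reverse (n : ℕ) (w : ℕ → ℤ) :
    evenSign n (fun c => - w (2 * n + 2 - c)) = - evenSign n w := by
  unfold evenSign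
  rw [← sum_range_reflect, ← sum_neg_distrib]
  refine sum_congr rfl fun j hj => ?_
  have := mem_range.1 hj
  rw [Int.sign_neg, show 2 * n + 2 - 2 * (n - 1 - j + 1) = 2 * (j + 1) by omega]

theorem sum_good_eq {n : ℕ} (F : (ℕ → ℤ) → ℤ) :
    ∑ E ∈ good n, F (walk n E) = ∑ E ∈ (range (2 * n + 2)).powerset,
      if Odd (walk n E 0) ∧ 0 < walk n E 0 then F (walk n E) else 0 := by
  rw [good, sum_filter]

/-- The terms of `sizeStat` that change sign under reversal cancel. -/
theorem sum_good_reverse (n : ℕ) :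
    ∑ E ∈ good n, (4 * absMoment n (walk n E) - 2 * absSum n (walk n E) * evenSign n (walk n E))
      = 0 := by
  rw [sum_good_eq (fun w => 4 * absMoment n w - 2 * absSum n w * evenSign n w)]
  have h := sum_reverse n (fun w => if Odd (w 0) ∧ 0 < w 0 then
    4 * absMoment n w - 2 * absSum n w * evenSign n w else 0) (fun w w' h => by
      simp only [h 0 (by omega), absMoment_congr h, absSum_congr h, evenSign_congr h])
  have h2 : ∀ E ∈ (range (2 * n + 2)).powerset,
      (if Odd (- walk n E (2 * n + 2 - 0)) ∧ 0 < - walk n E (2 * n + 2 - 0) then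
        4 * absMoment n (fun c => - walk n E (2 * n + 2 - c))
          - 2 * absSum n (fun c => - walk n E (2 * n + 2 - c))
            * evenSign n (fun c => - walk n E (2 * n + 2 - c)) else 0)
      = - (if Odd (walk n E 0) ∧ 0 < walk n E 0 then
        4 * absMoment n (walk n E) - 2 * absSum n (walk n E) * evenSign n (walk n E) else 0) := by
    intro E hE
    have he := walk_end (mem_powerset.1 hE)
    rw [Nat.sub_zero, he, neg_neg]
    split_ifs with h0
    · rw [absMoment_reverse he h0.2, absSum_reverse he, evenSign_reverse]
      ring
    · simp
  rw [sum_congr rfl h2, sum_neg_distrib] at h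
  linarith

/-- A statistic that is even under negation has the same sum over positive and negative odd
starting values. -/
theorem two_mul_sum_good (n : ℕ) (F : (ℕ → ℤ) → ℤ)
    (hF : ∀ w w', (∀ c ≤ 2 * n + 2, w c = w' c) → F w = F w') (hneg : ∀ w, F (fun c => - w c) = F w) :
    2 * ∑ E ∈ good n, F (walk n E)
      = ∑ E ∈ (range (2 * n + 2)).powerset, if Odd (walk n E 0) then F (walk n E) else 0 := by
  rw [sum_good_eq, two_mul]
  nth_rewrite 1 [← sum_neg n (fun w => if Odd (w 0) ∧ 0 < w 0 then F w else 0) (fun w w' h => by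
    simp only [h 0 (by omega), hF w w' h])]
  rw [← sum_add_distrib]
  refine sum_congr rfl fun E _ => ?_
  have hodd : Odd (- walk n E 0) ↔ Odd (walk n E 0) := by simp
  simp only [hneg, hodd]
  by_cases ho : Odd (walk n E 0)
  · have : walk n E 0 ≠ 0 := fun h => by simp [h] at ho
    rcases lt_or_gt_of_ne this with h | h
    · rw [if_pos ⟨ho, by omega⟩, if_neg (by omega), if_pos ho, add_zero]
    · rw [if_neg (by omega), if_pos ⟨ho, h⟩, if_pos ho, zero_add]
  · simp [ho]

/-- A rotation invariant statistic has the same sum over odd and even starting values. -/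
theorem two_mul_sum_odd (n : ℕ) (F : (ℕ → ℤ) → ℤ)
    (hF : ∀ w w', (∀ c ≤ 2 * n + 2, w c = w' c) → F w = F w')
    (hrot : ∀ w, w (2 * n + 2) = - w 0 →
      F (fun c => if c < 2 * n + 2 then w (c + 1) else - w 1) = F w) :
    2 * ∑ E ∈ (range (2 * n + 2)).powerset, (if Odd (walk n E 0) then F (walk n E) else 0)
      = ∑ E ∈ (range (2 * n + 2)).powerset, F (walk n E) := by
  rw [two_mul]
  nth_rewrite 1 [← sum_rotate n (fun w => if Odd (w 0) then F w else 0) (fun w w' h => by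
    simp only [h 0 (by omega), hF w w' h])]
  rw [← sum_add_distrib]
  refine sum_congr rfl fun E hE => ?_
  rw [hrot _ (walk_end (mem_powerset.1 hE))]
  dsimp only
  have h1 : Odd (if 0 < 2 * n + 2 then walk n E (0 + 1) else - walk n E 1)
      ↔ ¬ Odd (walk n E 0) := by
    rw [if_pos (by omega : 0 < 2 * n + 2), walk_succ, step, Int.odd_iff, Int.odd_iff]
    split_ifs <;> omega
  by_cases ho : Odd (walk n E 0)
  · rw [if_pos ho, if_neg (by tauto), zero_add]
  · rw [if_neg ho, if_pos (by tauto), add_zero]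

theorem sum_rotated {n : ℕ} {w : ℕ → ℤ} (hw : w (2 * n + 2) = - w 0) (f : ℤ → ℤ)
    (hf : ∀ x, f (-x) = f x) :
    ∑ c ∈ range (2 * n + 2), f (if c < 2 * n + 2 then w (c + 1) else - w 1)
      = ∑ c ∈ range (2 * n + 2), f (w c) := by
  have h1 := sum_range_succ (fun c => f (w c)) (2 * n + 2)
  rw [sum_range_succ', hw, hf] at h1
  rw [← add_right_cancel h1]
  exact sum_congr rfl fun c hc => by rw [if_pos (mem_range.1 hc)]

/-! ### Sums of the statistics -/

theorem sum_odd_sqSum (n : ℕ) :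
    ∑ E ∈ (range (2 * n + 2)).powerset, (if Odd (walk n E 0) then sqSum n (walk n E) else 0)
      = 2 * 4 ^ n * (n + 1) ^ 2 := by
  have h := two_mul_sum_odd n (sqSum n) (fun w w' h => sqSum_congr h)
    (fun w hw => sum_rotated hw (fun x => x ^ 2) (fun x => by ring))
  have h2 : 4 * ∑ E ∈ (range (2 * n + 2)).powerset, sqSum n (walk n E)
      = (2 * n + 2) * ((2 * n + 2) * 2 ^ (2 * n + 2)) := by
    unfold sqSum
    rw [sum_comm, mul_sum, sum_congr rfl fun c hc => by
      rw [mul_sum, sum_walk_sq (mem_range.1 hc).le], sum_const, card_range, nsmul_eq_mul]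
    push_cast
    ring
  have h3 : (2 : ℤ) ^ (2 * n + 2) = 4 ^ n * 4 := by
    rw [pow_add, pow_mul]; norm_num
  rw [h3] at h2
  linarith

theorem sum_odd_absSum_sq (n : ℕ) :
    ∑ E ∈ (range (2 * n + 2)).powerset, (if Odd (walk n E 0) then absSum n (walk n E) ^ 2 else 0)
      = 4 ^ n * (3 * (n + 1) ^ 3 - (n + 1) ^ 2) := by
  have h := two_mul_sum_odd n (fun w => absSum n w ^ 2) (fun w w' h => by rw [absSum_congr h])
    (fun w hw => by
      have := sum_rotated hw (fun x => |x|) abs_neg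
      unfold absSum
      rw [this])
  have h2 : 4 * ∑ E ∈ (range (2 * n + 2)).powerset, absSum n (walk n E) ^ 2
      = ∑ c ∈ range (2 * n + 1 + 1), ∑ d ∈ range (2 * n + 1 + 1), absCorr n (Nat.dist c d) := by
    simp only [absSum, sq, sum_mul_sum]
    rw [sum_comm, mul_sum]
    refine sum_congr rfl fun c hc => ?_
    rw [sum_comm, mul_sum]
    refine sum_congr rfl fun d hd => ?_
    have hc' := mem_range.1 hc
    have hd' := mem_range.1 hd
    rw [mul_sum]
    rcases le_total c d with hcd | hcd
    · rw [Nat.dist_eq_sub_of_le hcd, ← sum_abs_mul_abs (c := c) (by omega),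
        Nat.add_sub_cancel' hcd]
    · rw [Nat.dist_eq_sub_of_le_right hcd, ← sum_abs_mul_abs (c := d) (by omega),
        Nat.add_sub_cancel' hcd]
      exact sum_congr rfl fun E _ => by ring
  rw [sum_dist_of_symm _ _ (fun k hk => absCorr_symm hk), sum_absCorr, pow_succ] at h2
  push_cast at h2
  linarith

theorem odd_walk_even {n : ℕ} {E : Finset ℕ} (hE : E ⊆ range (2 * n + 2)) {k : ℕ}
    (hk : k ≤ n + 1) : Odd (walk n E (2 * k)) ↔ Odd (walk n E 0) := by
  have := (isWalk_walk hE).parity (c := 2 * k) (by omega)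
  rw [Int.odd_iff, Int.odd_iff]
  push_cast at this
  omega

theorem sum_odd_sign_mul {n i j : ℕ} (hij : i ≤ j) (hj : j ≤ n + 1) :
    ∑ E ∈ (range (2 * n + 2)).powerset, (if Odd (walk n E 0) then
      (walk n E (2 * i)).sign * (walk n E (2 * j)).sign else 0) = signCorr n (j - i) := by
  rw [← sum_oddSign_mul (i := i) (by omega), Nat.add_sub_cancel' hij]
  refine sum_congr rfl fun E hE => ?_
  have hE' := mem_powerset.1 hE
  simp only [oddSign_two_mul, odd_walk_even hE' hj, odd_walk_even hE' (hij.trans hj)]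
  split_ifs <;> simp

/-- An odd start is nonzero, so its squared sign is 1 and the count is the sign correlation at lag
0. -/
theorem sum_odd_one (n : ℕ) :
    ∑ E ∈ (range (2 * n + 2)).powerset, (if Odd (walk n E 0) then (1 : ℤ) else 0) = 2 * 4 ^ n := by
  rw [← signCorr_zero, ← Nat.sub_self 0, ← sum_odd_sign_mul le_rfl (by omega : 0 ≤ n + 1)]
  refine sum_congr rfl fun E _ => ?_
  split_ifs with h
  · have : walk n E 0 ≠ 0 := fun h0 => by simp [h0] at h
    rw [mul_zero, ← Int.sign_mul, Int.sign_eq_one_of_pos (mul_self_pos.2 this)]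
  · rfl

theorem two_mul_sum_odd_evenSignMoment (n : ℕ) :
    2 * ∑ E ∈ (range (2 * n + 2)).powerset, (if Odd (walk n E 0) then
      (walk n E 0).sign * evenSignMoment n (walk n E) else 0) = - (4 ^ n * (n * (n - 1))) := by
  rw [← sum_mul_signCorr, ← mul_neg, ← sum_neg_distrib]
  congr 1
  trans ∑ E ∈ (range (2 * n + 2)).powerset, ∑ k ∈ range n, (2 * (k : ℤ) + 1 - n) *
      (if Odd (walk n E 0) then (walk n E (2 * 0)).sign * (walk n E (2 * (k + 1))).sign else 0)
  · refine sum_congr rfl fun E _ => ?_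
    split_ifs
    · rw [evenSignMoment, mul_sum]
      exact sum_congr rfl fun k _ => by rw [mul_zero]; ring
    · simp
  · rw [sum_comm]
    refine sum_congr rfl fun k hk => ?_
    have := mem_range.1 hk
    rw [← mul_sum, sum_odd_sign_mul (by omega) (by omega), Nat.sub_zero]
    ring

theorem two_mul_sum_odd_evenSign_sq (n : ℕ) :
    2 * ∑ E ∈ (range (2 * n + 2)).powerset, (if Odd (walk n E 0) then
      evenSign n (walk n E) ^ 2 else 0) = 4 ^ n * (4 * n + n * (n - 1)) := by
  have h := sum_dist_of_antisymm (signCorr n) n (fun k hk => signCorr_symm hk)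
  have h2 := sum_mul_signCorr n
  rw [signCorr_zero] at h
  have h3 : ∑ E ∈ (range (2 * n + 2)).powerset, (if Odd (walk n E 0) then
      evenSign n (walk n E) ^ 2 else 0)
      = ∑ i ∈ range n, ∑ j ∈ range n, signCorr n (Nat.dist i j) := by
    trans ∑ E ∈ (range (2 * n + 2)).powerset, ∑ i ∈ range n, ∑ j ∈ range n,
      (if Odd (walk n E 0) then
        (walk n E (2 * (i + 1))).sign * (walk n E (2 * (j + 1))).sign else 0)
    · refine sum_congr rfl fun E _ => ?_
      split_ifs
      · rw [evenSign, sq, sum_mul_sum]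
      · simp
    · rw [sum_comm]
      refine sum_congr rfl fun i hi => ?_
      rw [sum_comm]
      refine sum_congr rfl fun j hj => ?_
      have hi' := mem_range.1 hi
      have hj' := mem_range.1 hj
      rcases le_total i j with hij | hij
      · rw [sum_odd_sign_mul (by omega) (by omega), Nat.dist_eq_sub_of_le hij,
          Nat.add_sub_add_right]
      · rw [Nat.dist_eq_sub_of_le_right hij, ← Nat.add_sub_add_right i 1 j,
          ← sum_odd_sign_mul (by omega) (by omega)]
        exact sum_congr rfl fun E _ => by rw [mul_comm]
  rw [h3, h]
  linarith

theorem card_good (n : ℕ) : #(good n) = 4 ^ n := by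
  have h := two_mul_sum_good n (fun _ => 1) (fun _ _ _ => rfl) (fun _ => rfl)
  rw [sum_odd_one, sum_const, nsmul_eq_mul, mul_one] at h
  have : (#(good n) : ℤ) = 4 ^ n := by linarith
  exact_mod_cast this

theorem sum_good_sizeStat (n : ℕ) :
    4 * ∑ E ∈ good n, sizeStat n (walk n E)
      = 4 ^ n * (10 * (n : ℤ) ^ 3 + 27 * n ^ 2 + 19 * n) := by
  -- `F` drops the terms cancelled by reversal. The factor sign(w 0), equal to 1 on good walks,
  -- makes the term with `evenSignMoment` even under negation, as `two_mul_sum_good` requires.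
  set F : (ℕ → ℤ) → ℤ := fun w => 4 * (n + 1) * sqSum n w
    + 4 * ((w 0).sign * evenSignMoment n w) - absSum n w ^ 2 - evenSign n w ^ 2
    + (1 - 4 * (n + 1)) * 1 with hF
  have h1 : ∑ E ∈ good n, sizeStat n (walk n E) = ∑ E ∈ good n, F (walk n E) := by
    rw [← add_zero (∑ E ∈ good n, F (walk n E)), ← sum_good_reverse, ← sum_add_distrib]
    refine sum_congr rfl fun E hE => ?_
    have h0 : 0 < walk n E 0 := (mem_filter.1 hE).2.2
    simp only [hF, sizeStat, Int.sign_eq_one_of_pos h0]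
    ring
  have h2 := two_mul_sum_good n F
    (fun w w' h => by simp only [hF, sqSum_congr h, h 0 (by omega), evenSignMoment_congr h,
      absSum_congr h, evenSign_congr h])
    (fun w => by simp [hF, sqSum, evenSignMoment, absSum, evenSign, Int.sign_neg])
  have h3 : ∑ E ∈ (range (2 * n + 2)).powerset, (if Odd (walk n E 0) then F (walk n E) else 0)
      = 4 * (n + 1) * ∑ E ∈ (range (2 * n + 2)).powerset,
          (if Odd (walk n E 0) then sqSum n (walk n E) else 0)
        + 4 * ∑ E ∈ (range (2 * n + 2)).powerset, (if Odd (walk n E 0) then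
          (walk n E 0).sign * evenSignMoment n (walk n E) else 0)
        - ∑ E ∈ (range (2 * n + 2)).powerset,
          (if Odd (walk n E 0) then absSum n (walk n E) ^ 2 else 0)
        - ∑ E ∈ (range (2 * n + 2)).powerset, (if Odd (walk n E 0) then
          evenSign n (walk n E) ^ 2 else 0)
        + (1 - 4 * (n + 1)) * ∑ E ∈ (range (2 * n + 2)).powerset,
          (if Odd (walk n E 0) then (1 : ℤ) else 0) := by
    rw [mul_sum, mul_sum, mul_sum, ← sum_add_distrib, ← sum_sub_distrib, ← sum_sub_distrib,
      ← sum_add_distrib]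
    refine sum_congr rfl fun E _ => ?_
    split_ifs
    · rfl
    · simp
  rw [h3, sum_odd_sqSum, sum_odd_absSum_sq, sum_odd_one] at h2
  rw [h1]
  linear_combination 2 * h2 + 4 * two_mul_sum_odd_evenSignMoment n
    - two_mul_sum_odd_evenSign_sq n

end SignWalk

/-! ### Encoding of hook length sets by good walks. -/

namespace SignWalk

open Finset

/-- A walk with odd positive starting value. -/
structure IsGood (n : ℕ) (w : ℕ → ℤ) : Prop extends IsWalk n w where
  odd_zero : w 0 % 2 = 1
  pos_zero : 0 < w 0

theorem IsGood.parity' {n : ℕ} {w : ℕ → ℤ} (hw : IsGood n w) {c : ℕ} (hc : c ≤ 2 * n + 2) :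
    (w c - 1 - c) % 2 = 0 := by
  have := hw.parity hc
  have := hw.odd_zero
  omega

/-- The cell of height `q` over column `c` is cut off by the walk, on the positive or negative
side according to the parity of `q + c`. -/
def Below (w : ℕ → ℤ) (q c : ℕ) : Prop :=
  ((q + c) % 2 = 0 ∧ (q : ℤ) < w c) ∨ ((q + c) % 2 = 1 ∧ (q : ℤ) < - w c)

/-- `x` belongs to the set of first column hook lengths encoded by `w`. -/
def InCode (n : ℕ) (w : ℕ → ℤ) (x : ℕ) : Prop :=
  Below w ((x + 1) / (2 * n + 2)) ((x + 1) % (2 * n + 2))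

theorem inCode_iff {n x q c : ℕ} (w : ℕ → ℤ) (hc : c < 2 * n + 2)
    (h : x + 1 = q * (2 * n + 2) + c) : InCode n w x ↔ Below w q c := by
  have h1 : (x + 1) / (2 * n + 2) = q := by
    rw [h, mul_comm, Nat.mul_add_div (by omega), Nat.div_eq_of_lt hc, add_zero]
  have h2 : (x + 1) % (2 * n + 2) = c := by
    rw [h, mul_comm, Nat.mul_add_mod, Nat.mod_eq_of_lt hc]
  rw [InCode, h1, h2]

theorem exists_coords (n x : ℕ) : ∃ q c, c < 2 * n + 2 ∧ x + 1 = q * (2 * n + 2) + c :=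
  ⟨(x + 1) / (2 * n + 2), (x + 1) % (2 * n + 2), Nat.mod_lt _ (by omega),
    (Nat.div_add_mod' _ _).symm⟩

/-- The sets of first column hook lengths of `(2 * n + 1, 2 * n + 3)`-cores with distinct parts. -/
structure IsDistinctCode (n : ℕ) (S : Finset ℕ) : Prop where
  zero_notMem : 0 ∉ S
  succ_notMem : ∀ x ∈ S, x + 1 ∉ S
  sub_mem : ∀ x ∈ S, 2 * n + 1 ≤ x → x - (2 * n + 1) ∈ S
  sub_mem' : ∀ x ∈ S, 2 * n + 3 ≤ x → x - (2 * n + 3) ∈ S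

/-- Passing from (q, c) to (q-1, c±1) keeps the parity of q + c and lowers the height by one, while
w changes by at most one. Consecutive cells have opposite parity, so containing both would need
neighbouring values of w at least 2 apart. At the edge of the strip, column 2n+2 of row q is column
0 of row q+1: the parity flips, and so does the sign, by w(2n+2) = -w(0). -/
theorem IsGood.isDistinctCode {n : ℕ} {w : ℕ → ℤ} (hw : IsGood n w) {S : Finset ℕ}
    (hS : ∀ x, x ∈ S ↔ InCode n w x) : IsDistinctCode n S := by
  have h0 := hw.pos_zero
  have ho := hw.odd_zero
  have hend := hw.end_eq
  have hlast := hw.step_eq (2 * n + 1) (by omega)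
  rw [show 2 * n + 1 + 1 = 2 * n + 2 from rfl, hend] at hlast
  constructor
  · rw [hS, inCode_iff (q := 0) (c := 1) w (by omega) (by omega), Below]
    have := hw.step_eq 0 (by omega)
    rw [zero_add] at this
    omega
  · intro x hx hx'
    obtain ⟨q, c, hc, hqc⟩ := exists_coords n x
    rw [hS, inCode_iff w hc hqc, Below] at hx
    by_cases h : c + 1 < 2 * n + 2
    · rw [hS, inCode_iff (q := q) w h (by omega), Below] at hx'
      have := hw.step_eq c hc
      omega
    · obtain rfl : c = 2 * n + 1 := by omega
      rw [hS, inCode_iff (q := q + 1) (c := 0) w (by omega) (by rw [add_mul]; omega), Below] at hx'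
      omega
  · intro x hx hxs
    obtain ⟨q, c, hc, hqc⟩ := exists_coords n x
    rw [hS, inCode_iff w hc hqc, Below] at hx
    obtain ⟨q, rfl⟩ : ∃ p, q = p + 1 := Nat.exists_eq_add_one.2 (by
      rcases Nat.eq_zero_or_pos q with rfl | h
      · omega
      · exact h)
    rw [add_mul] at hqc
    by_cases h : c + 1 < 2 * n + 2
    · rw [hS, inCode_iff (q := q) w h (by omega), Below]
      have := hw.step_eq c hc
      omega
    · obtain rfl : c = 2 * n + 1 := by omega
      rw [hS, inCode_iff (q := q + 1) (c := 0) w (by omega) (by rw [add_mul]; omega), Below]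
      omega
  · intro x hx hxs
    obtain ⟨q, c, hc, hqc⟩ := exists_coords n x
    rw [hS, inCode_iff w hc hqc, Below] at hx
    obtain ⟨q, rfl⟩ : ∃ p, q = p + 1 := Nat.exists_eq_add_one.2 (by
      rcases Nat.eq_zero_or_pos q with rfl | h
      · omega
      · exact h)
    rw [add_mul] at hqc
    by_cases h : c = 0
    · subst h
      obtain ⟨q, rfl⟩ : ∃ p, q = p + 1 := Nat.exists_eq_add_one.2 (by
        rcases Nat.eq_zero_or_pos q with rfl | h
        · omega
        · exact h)
      rw [add_mul] at hqc
      rw [hS, inCode_iff (q := q) (c := 2 * n + 1) w (by omega) (by omega), Below]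
      omega
    · rw [hS, inCode_iff (q := q) (c := c - 1) w (by omega) (by omega), Below]
      have := hw.step_eq (c - 1) (by omega)
      rw [Nat.sub_add_cancel (by omega)] at this
      omega

theorem exists_code {n : ℕ} (w : ℕ → ℤ) : ∃ S : Finset ℕ, ∀ x, x ∈ S ↔ InCode n w x := by
  have hfin : {x | InCode n w x}.Finite := by
    refine (Set.finite_lt_nat ((∑ c ∈ range (2 * n + 2), (w c).natAbs) * (2 * n + 2))).subset ?_
    intro x hx
    obtain ⟨q, c, hc, hqc⟩ := exists_coords n x
    rw [Set.mem_ofPred_eq, inCode_iff w hc hqc, Below] at hx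
    have h1 : (w c).natAbs ≤ ∑ c ∈ range (2 * n + 2), (w c).natAbs :=
      single_le_sum (f := fun c => (w c).natAbs) (fun _ _ => Nat.zero_le _) (mem_range.2 hc)
    have h2 : q + 1 ≤ ∑ c ∈ range (2 * n + 2), (w c).natAbs := by omega
    have h3 := Nat.mul_le_mul_right (2 * n + 2) h2
    rw [add_mul] at h3
    rw [Set.mem_ofPred_eq]
    omega
  exact ⟨hfin.toFinset, fun x => by simp⟩

/-- The parity of w(c) is prescribed, so the cut in column c determines it. The cell q = c = 0
stands for x = -1 and carries no information, which is harmless because both starts are odd and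
positive. -/
theorem IsGood.eq_of_inCode_iff {n : ℕ} {w w' : ℕ → ℤ} (hw : IsGood n w) (hw' : IsGood n w')
    (h : ∀ x, InCode n w x ↔ InCode n w' x) : ∀ c ≤ 2 * n + 2, w c = w' c := by
  have key : ∀ w w' : ℕ → ℤ, IsGood n w → IsGood n w' → (∀ x, InCode n w x ↔ InCode n w' x) →
      ∀ c < 2 * n + 2, w c ≤ w' c := by
    intro w w' hw hw' h c hc
    by_contra! hlt
    have h1 := hw.parity' hc.le
    have h2 := hw'.parity' hc.le
    have h3 : ∀ q : ℕ, (q ≠ 0 ∨ c ≠ 0) → (Below w q c ↔ Below w' q c) := by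
      intro q hq
      have hpos : 0 < q * (2 * n + 2) + c := by
        rcases hq with hq | hq
        · have := Nat.mul_pos (Nat.pos_of_ne_zero hq) (by omega : 0 < 2 * n + 2)
          omega
        · omega
      rw [← inCode_iff (x := q * (2 * n + 2) + c - 1) w hc (by omega),
        ← inCode_iff (x := q * (2 * n + 2) + c - 1) w' hc (by omega)]
      exact h _
    have h4 := hw.pos_zero
    have h5 := hw'.pos_zero
    -- If w(c) > w'(c), the separating cell is the topmost one under w on the positive side when
    -- w(c) ≥ 1, and otherwise the cell of height -w(c), cut off by w' on the negative side but not
    -- by w.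
    by_cases hp : 1 ≤ w c
    · have := h3 (w c - 1).toNat (by
        by_contra! hh
        obtain ⟨hh, rfl⟩ := hh
        omega)
      simp only [Below] at this
      omega
    · have := h3 (- w c).toNat (by
        by_contra! hh
        obtain ⟨hh, rfl⟩ := hh
        omega)
      simp only [Below] at this
      omega
  have hlt : ∀ c < 2 * n + 2, w c = w' c := fun c hc =>
    le_antisymm (key w w' hw hw' h c hc) (key w' w hw' hw (fun x => (h x).symm) c hc)
  intro c hc
  rcases hc.lt_or_eq with hc | rfl
  · exact hlt c hc
  · rw [hw.end_eq, hw'.end_eq, hlt 0 (by omega)]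

/-! ### Size statistics, column by column -/

/-- Twice the number of elements in the columns `c` and `c - (2 * n + 2)`. -/
def colCard (c : ℕ) (v : ℤ) : ℤ :=
  |v| + (if Even c then v.sign else 0) - (if c = 0 then 2 else 0)

/-- Twice the sum of the elements in the columns `c` and `c - (2 * n + 2)`. -/
def colSum (n c : ℕ) (v : ℤ) : ℤ :=
  (n + 1) * v ^ 2 + ((c : ℤ) - (n + 1)) * |v| + (n + 1) * v - |v|
    + (if Even c then ((c : ℤ) - (n + 1) - 1) * v.sign else 0) + (if c = 0 then 2 else 0)

/-- `w` encodes `S`, and the cardinality and sum of `S` are the sums of the column statistics. -/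
structure Encodes (n : ℕ) (w : ℕ → ℤ) (S : Finset ℕ) : Prop where
  mem_iff : ∀ x, x ∈ S ↔ InCode n w x
  card_eq : 2 * (#S : ℤ) = ∑ c ∈ range (2 * n + 2), colCard c (w c)
  sum_eq : 2 * ∑ x ∈ S, (x : ℤ) = ∑ c ∈ range (2 * n + 2), colSum n c (w c)

theorem sum_apply_of_eq_off {m c : ℕ} (hc : c < m) {w w' : ℕ → ℤ}
    (h : ∀ i < m, i ≠ c → w' i = w i) (F : ℕ → ℤ → ℤ) :
    ∑ i ∈ range m, F i (w' i) = ∑ i ∈ range m, F i (w i) + (F c (w' c) - F c (w c)) := by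
  rw [← sub_eq_iff_eq_add', ← sum_sub_distrib]
  refine sum_eq_single c (fun i hi hic => ?_) fun hn => absurd (mem_range.2 hc) hn
  rw [h i (mem_range.1 hi) hic, sub_self]

/-- Raising the column value from q-1 to q+1 on the positive side adds exactly the cell (q, c). The
excluded case c = 0, q < 2 would involve the fictitious element x = -1, which the terms with c = 0
discount. -/
theorem colCard_up {q c : ℕ} (hqc : (q + c) % 2 = 0) (h : c ≠ 0 ∨ 2 ≤ q) :
    colCard c (q + 1) - colCard c (q - 1) = 2 := by
  unfold colCard
  rcases Nat.eq_zero_or_pos q with rfl | hq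
  · have : Even c := by rw [Nat.even_iff]; omega
    simp [this]
  · rcases Nat.even_or_odd c with hc | hc
    · have hq2 : 2 ≤ q := by rw [Nat.even_iff] at hc; omega
      rw [abs_of_pos (by omega), abs_of_pos (by omega), Int.sign_eq_one_of_pos (by omega),
        Int.sign_eq_one_of_pos (by omega)]
      ring
    · rw [if_neg (Nat.not_even_iff_odd.2 hc), abs_of_pos (by omega),
        abs_of_nonneg (by omega), if_neg (Nat.not_even_iff_odd.2 hc)]
      ring

theorem colSum_up {n q c : ℕ} (hqc : (q + c) % 2 = 0) (h : c ≠ 0 ∨ 2 ≤ q) :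
    colSum n c (q + 1) - colSum n c (q - 1) = 2 * (q * (2 * n + 2) + c - 1) := by
  unfold colSum
  rcases Nat.eq_zero_or_pos q with rfl | hq
  · have : Even c := by rw [Nat.even_iff]; omega
    simp [this]
    ring
  · rcases Nat.even_or_odd c with hc | hc
    · have hq2 : 2 ≤ q := by rw [Nat.even_iff] at hc; omega
      rw [abs_of_pos (by omega), abs_of_pos (by omega), Int.sign_eq_one_of_pos (by omega),
        Int.sign_eq_one_of_pos (by omega)]
      ring
    · rw [if_neg (Nat.not_even_iff_odd.2 hc), abs_of_pos (by omega),
        abs_of_nonneg (by omega), if_neg (Nat.not_even_iff_odd.2 hc)]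
      ring

theorem colCard_down {q c : ℕ} (hqc : (q + c) % 2 = 1) :
    colCard c (-q - 2) - colCard c (-q) = 2 := by
  unfold colCard
  rcases Nat.even_or_odd c with hc | hc
  · have hq2 : 1 ≤ q := by rw [Nat.even_iff] at hc; omega
    rw [abs_of_neg (by omega), abs_of_neg (by omega), Int.sign_eq_neg_one_of_neg (by omega),
      Int.sign_eq_neg_one_of_neg (by omega)]
    ring
  · rw [if_neg (Nat.not_even_iff_odd.2 hc), abs_of_neg (by omega),
      abs_of_nonpos (by omega), if_neg (Nat.not_even_iff_odd.2 hc)]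
    ring

theorem colSum_down {n q c : ℕ} (hqc : (q + c) % 2 = 1) :
    colSum n c (-q - 2) - colSum n c (-q) = 2 * (q * (2 * n + 2) + c - 1) := by
  unfold colSum
  rcases Nat.even_or_odd c with hc | hc
  · have hq2 : 1 ≤ q := by rw [Nat.even_iff] at hc; omega
    rw [abs_of_neg (by omega), abs_of_neg (by omega), Int.sign_eq_neg_one_of_neg (by omega),
      Int.sign_eq_neg_one_of_neg (by omega)]
    ring
  · rw [if_neg (Nat.not_even_iff_odd.2 hc), abs_of_neg (by omega),
      abs_of_nonpos (by omega), if_neg (Nat.not_even_iff_odd.2 hc)]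
    ring

/-- Flipping a walk at a local extremum adds one element to the encoded set. -/
theorem Encodes.insert {n a q c : ℕ} {w w' : ℕ → ℤ} {S : Finset ℕ} (h : Encodes n w S)
    (haS : a ∉ S) (hc : c < 2 * n + 2) (ha : a + 1 = q * (2 * n + 2) + c) (hcq : c ≠ 0 ∨ 2 ≤ q)
    (hoff : ∀ i < 2 * n + 2, i ≠ c → w' i = w i)
    (hflip : ((q + c) % 2 = 0 ∧ w c = q - 1 ∧ w' c = q + 1)
      ∨ ((q + c) % 2 = 1 ∧ w c = -q ∧ w' c = -q - 2)) :
    Encodes n w' (insert a S) where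
  mem_iff x := by
    obtain ⟨p, d, hd, hpd⟩ := exists_coords n x
    rw [mem_insert, h.mem_iff, inCode_iff w hd hpd, inCode_iff w' hd hpd, Below, Below]
    by_cases hdc : d = c
    · subst hdc
      have hx : x = a ↔ p = q := by
        constructor
        · rintro rfl
          have : p * (2 * n + 2) = q * (2 * n + 2) := by omega
          exact Nat.eq_of_mul_eq_mul_right (by omega) this
        · rintro rfl
          omega
      rw [hx]
      omega
    · have hx : x ≠ a := by
        rintro rfl
        apply hdc
        have h1 := congrArg (· % (2 * n + 2)) hpd
        have h2 := congrArg (· % (2 * n + 2)) ha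
        simp only [Nat.mul_add_mod', Nat.mod_eq_of_lt hd, Nat.mod_eq_of_lt hc] at h1 h2
        exact h1.symm.trans h2
      rw [hoff d hd hdc]
      simp [hx]
  card_eq := by
    rw [card_insert_of_notMem haS, sum_apply_of_eq_off hc hoff, ← h.card_eq]
    rcases hflip with ⟨h1, h2, h3⟩ | ⟨h1, h2, h3⟩
    · rw [h2, h3, colCard_up h1 hcq]; push_cast; ring
    · rw [h2, h3, colCard_down h1]; push_cast; ring
  sum_eq := by
    have ha' : (a : ℤ) = q * (2 * n + 2) + c - 1 := by
      have : ((a + 1 : ℕ) : ℤ) = ((q * (2 * n + 2) + c : ℕ) : ℤ) := by rw [ha]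
      push_cast at this
      linarith
    rw [sum_insert haS, sum_apply_of_eq_off hc hoff (colSum n), ← h.sum_eq]
    rcases hflip with ⟨h1, h2, h3⟩ | ⟨h1, h2, h3⟩
    · rw [h2, h3, colSum_up h1 hcq, ha']; ring
    · rw [h2, h3, colSum_down h1, ha']; ring

/-- The walk encoding the empty partition. -/
def zigzag (c : ℕ) : ℤ := if c = 0 then 1 else if Even c then -1 else 0

theorem isGood_zigzag (n : ℕ) : IsGood n zigzag where
  step_eq c _ := by
    rcases Nat.even_or_odd c with h | h
    · have : ¬ Even (c + 1) := by rw [Nat.even_iff] at *; omega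
      by_cases h0 : c = 0 <;> simp [zigzag, h, this, h0]
    · have h1 : ¬ Even c := Nat.not_even_iff_odd.2 h
      have : Even (c + 1) := h.add_one
      have h0 : c ≠ 0 := by rintro rfl; simp at h
      simp [zigzag, h1, this, h0]
  end_eq := by
    have : Even (2 * n + 2) := by rw [Nat.even_iff]; omega
    simp [zigzag, this]
  odd_zero := rfl
  pos_zero := Int.one_pos

theorem encodes_zigzag (n : ℕ) : Encodes n zigzag ∅ where
  mem_iff x := by
    obtain ⟨q, c, hc, hqc⟩ := exists_coords n x
    rw [inCode_iff _ hc hqc, Below]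
    simp only [zigzag, Nat.even_iff]
    by_cases hq : q = 0
    · subst hq
      have h0 : c ≠ 0 := by omega
      rw [if_neg h0]
      split_ifs
      · simp
        omega
      · simp
    · simp only [notMem_empty, false_iff]
      split_ifs <;> omega
  card_eq := by
    rw [card_empty, Nat.cast_zero, mul_zero]
    refine (sum_eq_zero fun c _ => ?_).symm
    rw [colCard, zigzag]
    split_ifs <;> simp_all
  sum_eq := by
    rw [sum_empty, mul_zero]
    refine (sum_eq_zero fun c _ => ?_).symm
    by_cases h0 : c = 0
    · subst h0
      simp [colSum, zigzag]
      ring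
    · by_cases he : Even c <;> simp [colSum, zigzag, h0, he]

end SignWalk

/-! ### Existence of the encoding walk. -/

namespace SignWalk

open Finset

theorem below_even (w : ℕ → ℤ) {q c : ℕ} (h : (q + c) % 2 = 0) : Below w q c ↔ (q : ℤ) < w c := by
  rw [Below]
  omega

theorem below_odd (w : ℕ → ℤ) {q c : ℕ} (h : (q + c) % 2 = 1) : Below w q c ↔ (q : ℤ) < - w c := by
  rw [Below]
  omega

set_option maxHeartbeats 1000000 in
/-- Every admissible set is encoded by a good walk. -/
theorem IsDistinctCode.exists_encodes (n : ℕ) (S : Finset ℕ) :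
    IsDistinctCode n S → ∃ w, IsGood n w ∧ Encodes n w S := by
  -- Removing the maximum a leaves an admissible set. Its walk must have a local extremum in the
  -- column of a, and flipping that extremum adds a.
  induction S using Finset.induction_on_max with
  | empty => exact fun _ => ⟨zigzag, isGood_zigzag n, encodes_zigzag n⟩
  | insert a S hmax ih =>
    intro hv
    have haS : a ∉ S := fun h => (hmax a h).false
    have ha0 : a ≠ 0 := by
      rintro rfl
      exact hv.zero_notMem (mem_insert_self _ _)
    have hpred : ∀ x ∈ insert a S, ∀ d, 0 < d → x - d ∈ insert a S → x - d ∈ S := by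
      intro x hx d hd h
      rcases mem_insert.1 h with h | h
      · rcases mem_insert.1 hx with hx | hx
        · omega
        · have := hmax x hx
          omega
      · exact h
    have hvS : IsDistinctCode n S :=
      ⟨fun h => hv.zero_notMem (mem_insert_of_mem h),
        fun x hx h => hv.succ_notMem x (mem_insert_of_mem hx) (mem_insert_of_mem h),
        fun x hx h => hpred x (mem_insert_of_mem hx) _ (by omega)
          (hv.sub_mem x (mem_insert_of_mem hx) h),
        fun x hx h => hpred x (mem_insert_of_mem hx) _ (by omega)
          (hv.sub_mem' x (mem_insert_of_mem hx) h)⟩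
    obtain ⟨w, hw, hwS⟩ := ih hvS
    obtain ⟨q, c, hc, hqc⟩ := exists_coords n a
    have hnot := haS
    rw [hwS.mem_iff, inCode_iff w hc hqc, Below] at hnot
    have h0 := hw.pos_zero
    have ho := hw.odd_zero
    have hend := hw.end_eq
    have hpar := hw.parity' hc.le
    have hstep := hw.step_eq c hc
    have hlast := hw.step_eq (2 * n + 1) (by omega)
    rw [show 2 * n + 1 + 1 = 2 * n + 2 from rfl, hend] at hlast
    have hfirst := hw.step_eq 0 (by omega)
    rw [zero_add] at hfirst
    -- the elements below `a` in the two neighbouring columns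
    have hright : ∀ p, q = p + 1 → c + 1 < 2 * n + 2 → Below w p (c + 1) := by
      rintro p rfl hc'
      rw [add_mul] at hqc
      have h := hpred a (mem_insert_self _ _) _ (by omega)
        (hv.sub_mem a (mem_insert_self _ _) (by omega))
      rwa [hwS.mem_iff, inCode_iff (q := p) (c := c + 1) w hc' (by omega)] at h
    have hright' : q ≠ 0 → c = 2 * n + 1 → Below w q 0 := by
      rintro hq rfl
      obtain ⟨p, rfl⟩ := Nat.exists_eq_succ_of_ne_zero hq
      rw [Nat.succ_eq_add_one, add_mul] at hqc
      have h := hpred a (mem_insert_self _ _) _ (by omega)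
        (hv.sub_mem a (mem_insert_self _ _) (by omega))
      rwa [hwS.mem_iff, inCode_iff (q := p + 1) (c := 0) w (by omega) (by rw [add_mul]; omega)] at h
    have hleft : ∀ p d, q = p + 1 → c = d + 1 → p + d ≠ 0 → Below w p d := by
      rintro p d rfl rfl hpd
      have hpos : 0 < p * (2 * n + 2) + d := by
        rcases Nat.eq_zero_or_pos p with rfl | hp
        · omega
        · have := Nat.mul_pos hp (by omega : 0 < 2 * n + 2)
          omega
      rw [add_mul] at hqc
      have h := hpred a (mem_insert_self _ _) _ (by omega)
        (hv.sub_mem' a (mem_insert_self _ _) (by omega))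
      rwa [hwS.mem_iff, inCode_iff (q := p) (c := d) w (by omega) (by omega)] at h
    have hleft' : ∀ p, q = p + 2 → c = 0 → Below w p (2 * n + 1) := by
      rintro p rfl rfl
      rw [add_mul] at hqc
      have h := hpred a (mem_insert_self _ _) _ (by omega)
        (hv.sub_mem' a (mem_insert_self _ _) (by omega))
      rwa [hwS.mem_iff, inCode_iff (q := p) (c := 2 * n + 1) w (by omega) (by omega)] at h
    -- In row 0 the closure conditions say nothing; the neighbouring cells are a - 1 and a + 1,
    -- excluded by distinctness and by maximality respectively.
    have hprev : ∀ d, q = 0 → c = d + 1 → d ≠ 0 → ¬ Below w 0 d := by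
      rintro d rfl rfl hd h
      rw [← inCode_iff (n := n) (x := a - 1) (q := 0) (c := d) w (by omega) (by omega), ← hwS.mem_iff] at h
      refine hv.succ_notMem _ (mem_insert_of_mem h) ?_
      rw [Nat.sub_add_cancel (by omega)]
      exact mem_insert_self _ _
    have hnext : q = 0 → c + 1 < 2 * n + 2 → ¬ Below w 0 (c + 1) := by
      rintro rfl hc' h
      rw [← inCode_iff (n := n) (x := a + 1) (q := 0) (c := c + 1) w (by omega) (by omega), ← hwS.mem_iff] at h
      exact absurd (hmax _ h) (by omega)
    rcases Nat.eq_zero_or_pos c with rfl | hc0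
    · have hq0 : q ≠ 0 := by rintro rfl; omega
      obtain ⟨p, rfl⟩ := Nat.exists_eq_succ_of_ne_zero hq0
      have h1 := hright p rfl (by omega)
      rw [Below, zero_add] at h1
      obtain ⟨r, rfl⟩ : ∃ r, p = r + 1 := Nat.exists_eq_add_one.2 (by omega)
      have h2 := hleft' r rfl rfl
      rw [Below] at h2
      have e0 : w 0 = r + 1 := by omega
      have e1 : w 1 = r + 2 := by omega
      have e2 : w (2 * n + 1) = - r - 2 := by omega
      -- In column 0 the extremum sits at the seam of the antiperiodic walk: raising the start from
      -- r+1 to r+3 (here q = r+2) forces the end down to -r-3.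
      refine ⟨fun i => if i = 0 then (r : ℤ) + 3 else if i = 2 * n + 2 then -(r : ℤ) - 3 else w i,
        ⟨⟨fun i hi => ?_, ?_⟩, ?_, ?_⟩, hwS.insert haS hc hqc (Or.inr (by omega)) ?_
          (Or.inl ⟨by omega, by omega, ?_⟩)⟩
      · rw [if_neg (by omega : i + 1 ≠ 0), if_neg (by omega : i ≠ 2 * n + 2)]
        by_cases hi0 : i = 0
        · subst hi0
          rw [if_pos rfl, if_neg (by omega), zero_add, e1]
          right
          ring
        · rw [if_neg hi0]
          by_cases hi1 : i = 2 * n + 1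
          · subst hi1
            rw [if_pos rfl]
            omega
          · rw [if_neg (by omega)]
            exact hw.step_eq i hi
      · rw [if_neg (by omega), if_pos rfl, if_pos rfl]
        ring
      · rw [if_pos rfl]
        omega
      · rw [if_pos rfl]
        omega
      · intro i hi hi0
        rw [if_neg hi0, if_neg (by omega)]
      · rw [if_pos rfl]
        push_cast
        ring
    · obtain ⟨d, rfl⟩ : ∃ d, c = d + 1 := Nat.exists_eq_add_one.2 hc0
      have hstepL := hw.step_eq d (by omega)
      have hparL := hw.parity' (c := d) (by omega)
      have hparR := hw.parity' (c := d + 1 + 1) (by omega)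
      -- The walk has a local minimum q-1 (even cell) or a local maximum -q (odd cell) at column
      -- d+1. As a is not yet encoded and parities are fixed, one-sided bounds on the two neighbours
      -- suffice.
      have key : ((q + (d + 1)) % 2 = 0 ∧ w d = q ∧ w (d + 1) = q - 1 ∧ w (d + 1 + 1) = q)
          ∨ ((q + (d + 1)) % 2 = 1 ∧ w d = -q - 1 ∧ w (d + 1) = -q ∧ w (d + 1 + 1) = -q - 1) := by
        rw [← Below] at hnot
        clear hfirst hmax ih hv hpred hvS
        rcases Nat.mod_two_eq_zero_or_one (q + (d + 1)) with hpar2 | hpar2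
        · left
          rw [below_even w hpar2] at hnot
          suffices h : (q : ℤ) ≤ w d ∧ (q : ℤ) ≤ w (d + 1 + 1) by
            clear hleft hright hright' hprev hnext hlast hqc
            omega
          constructor
          · rcases Nat.eq_zero_or_pos q with rfl | hq
            · have h := hprev d rfl rfl (by omega)
              rw [below_odd w (by omega)] at h
              omega
            · obtain ⟨p, rfl⟩ : ∃ p, q = p + 1 := Nat.exists_eq_add_one.2 hq
              by_cases hpd : p + d = 0
              · obtain ⟨rfl, rfl⟩ : p = 0 ∧ d = 0 := by omega
                omega
              · have h := hleft p d rfl rfl hpd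
                rw [below_even w (by omega)] at h
                omega
          · have hq : q ≠ 0 → d + 1 + 1 < 2 * n + 2 := by
              intro hq
              by_contra hR
              have h := hright' hq (by omega)
              rw [below_odd w (by omega)] at h
              omega
            rcases Nat.eq_zero_or_pos q with rfl | hq0
            · have h := hnext rfl (by omega)
              rw [below_odd w (by omega)] at h
              omega
            · obtain ⟨p, rfl⟩ : ∃ p, q = p + 1 := Nat.exists_eq_add_one.2 hq0
              have h := hright p rfl (hq (by omega))
              rw [below_even w (by omega)] at h
              omega
        · right
          rw [below_odd w hpar2] at hnot
          suffices h : w d ≤ -q - 1 ∧ w (d + 1 + 1) ≤ -q - 1 by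
            clear hleft hright hright' hprev hnext hlast hqc
            omega
          constructor
          · rcases Nat.eq_zero_or_pos q with rfl | hq
            · have h := hprev d rfl rfl (by rintro rfl; omega)
              rw [below_even w (by omega)] at h
              omega
            · obtain ⟨p, rfl⟩ : ∃ p, q = p + 1 := Nat.exists_eq_add_one.2 hq
              have h := hleft p d rfl rfl (by omega)
              rw [below_odd w (by omega)] at h
              omega
          · by_cases hR : d + 1 + 1 < 2 * n + 2
            · rcases Nat.eq_zero_or_pos q with rfl | hq0
              · have h := hnext rfl hR
                rw [below_even w (by omega)] at h
                omega
              · obtain ⟨p, rfl⟩ : ∃ p, q = p + 1 := Nat.exists_eq_add_one.2 hq0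
                have h := hright p rfl hR
                rw [below_odd w (by omega)] at h
                omega
            · rw [show d + 1 + 1 = 2 * n + 2 by omega, hend]
              rcases Nat.eq_zero_or_pos q with rfl | hq0
              · omega
              · have h := hright' (by omega) (by omega)
                rw [below_even w (by omega)] at h
                omega
      have walkOf : ∀ v : ℤ, (v = w d + 1 ∨ v = w d - 1) →
          (w (d + 1 + 1) = v + 1 ∨ w (d + 1 + 1) = v - 1) →
          IsGood n (Function.update w (d + 1) v) := by
        intro v h1 h2
        refine ⟨⟨fun i hi => ?_, ?_⟩, ?_, ?_⟩
        · by_cases e1 : i = d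
          · subst e1
            rw [Function.update_self, Function.update_of_ne (by omega)]
            exact h1
          · by_cases e2 : i = d + 1
            · subst e2
              rw [Function.update_self, Function.update_of_ne (by omega)]
              exact h2
            · rw [Function.update_of_ne (by omega), Function.update_of_ne (by omega)]
              exact hw.step_eq i hi
        · rw [Function.update_of_ne (by omega), Function.update_of_ne (by omega)]
          exact hend
        · rw [Function.update_of_ne (by omega)]
          exact ho
        · rw [Function.update_of_ne (by omega)]
          exact h0
      have hoff : ∀ v : ℤ, ∀ i < 2 * n + 2, i ≠ d + 1 → Function.update w (d + 1) v i = w i :=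
        fun v i _ hi => Function.update_of_ne hi _ _
      rcases key with ⟨k0, k1, k2, k3⟩ | ⟨k0, k1, k2, k3⟩
      · exact ⟨Function.update w (d + 1) (q + 1),
          walkOf _ (Or.inl (by rw [k1])) (Or.inr (by rw [k3]; ring)),
          hwS.insert haS hc hqc (Or.inl (Nat.succ_ne_zero d)) (hoff _)
            (Or.inl ⟨k0, k2, Function.update_self _ _ _⟩)⟩
      · exact ⟨Function.update w (d + 1) (-q - 2),
          walkOf _ (Or.inr (by rw [k1]; ring)) (Or.inl (by rw [k3]; ring)),
          hwS.insert haS hc hqc (Or.inl (Nat.succ_ne_zero d)) (hoff _)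
            (Or.inr ⟨k0, k2, Function.update_self _ _ _⟩)⟩

end SignWalk

/-! ### First column hook lengths of a Young diagram. -/

namespace YoungDiagram

open Finset

/-- The hook length of the first cell of row `i`, for `i` less than the number of rows. -/
def firstColHook (μ : YoungDiagram) (i : ℕ) : ℕ := μ.rowLen i + (μ.colLen 0 - 1 - i)

/-- The set of first column hook lengths. -/
def firstColHooks (μ : YoungDiagram) : Finset ℕ := (range (μ.colLen 0)).image μ.firstColHook

theorem lt_rowLen_iff (μ : YoungDiagram) (i j : ℕ) : j < μ.rowLen i ↔ i < μ.colLen j := by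
  rw [← mem_iff_lt_rowLen, mem_iff_lt_colLen]

theorem firstColHook_lt {μ : YoungDiagram} {i j : ℕ} (hij : i < j) (hj : j < μ.colLen 0) :
    μ.firstColHook j < μ.firstColHook i := by
  have := μ.rowLen_anti i j hij.le
  unfold firstColHook
  omega

theorem firstColHook_injOn (μ : YoungDiagram) :
    Set.InjOn μ.firstColHook (range (μ.colLen 0)) := by
  intro i hi j hj h
  have hi := mem_range.1 hi
  have hj := mem_range.1 hj
  rcases lt_trichotomy i j with hij | hij | hij
  · exact absurd h (firstColHook_lt hij hj).ne'
  · exact hij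
  · exact absurd h (firstColHook_lt hij hi).ne

theorem card_firstColHooks (μ : YoungDiagram) : #μ.firstColHooks = μ.colLen 0 := by
  rw [firstColHooks, card_image_of_injOn μ.firstColHook_injOn, card_range]

theorem zero_notMem_firstColHooks (μ : YoungDiagram) : 0 ∉ μ.firstColHooks := by
  simp only [firstColHooks, mem_image, mem_range, not_exists, not_and, firstColHook]
  intro i hi
  have := (μ.lt_rowLen_iff i 0).2 hi
  omega

/-- The non-elements of the set of first column hook lengths correspond to the columns. -/
theorem exists_add_colLen_eq {μ : YoungDiagram} {y : ℕ} (hy : y ∉ μ.firstColHooks) :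
    ∃ j, y + μ.colLen j = j + μ.colLen 0 := by
  have hex : ∃ i, μ.colLen 0 ≤ i ∨ μ.firstColHook i ≤ y := ⟨_, Or.inl le_rfl⟩
  classical
  set b := Nat.find hex with hb
  -- b is the number of rows whose first column hook exceeds y; the column sought is j = y + b -
  -- `μ.colLen 0`, and it has length b.
  have hbk : b ≤ μ.colLen 0 := Nat.find_min' hex (Or.inl le_rfl)
  have hlt : ∀ i < b, i < μ.colLen 0 ∧ y < μ.firstColHook i := fun i hi => by
    have := Nat.find_min hex hi
    omega
  have hspec := Nat.find_spec hex
  rw [← hb] at hspec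
  have hy' : ∀ i < μ.colLen 0, μ.firstColHook i ≠ y := fun i hi h =>
    hy (mem_image.2 ⟨i, mem_range.2 hi, h⟩)
  have hkb : μ.colLen 0 ≤ y + b := by
    by_contra! hcon
    have h1 := hy' b (by omega)
    have h2 : 0 < μ.rowLen b := (μ.lt_rowLen_iff b 0).2 (by omega)
    rw [firstColHook] at *
    omega
  refine ⟨y + b - μ.colLen 0, ?_⟩
  have key : μ.colLen (y + b - μ.colLen 0) = b := by
    refine Nat.le_antisymm ?_ ?_
    · by_contra! hcon
      have h1 := (μ.lt_rowLen_iff b _).2 hcon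
      have h2 : 0 < μ.rowLen b := by omega
      have h3 := (μ.lt_rowLen_iff b 0).1 h2
      have h4 := hy' b h3
      rw [firstColHook] at *
      omega
    · rcases Nat.eq_zero_or_pos b with h0 | h0
      · omega
      · have h1 := hlt (b - 1) (by omega)
        have h2 : y + b - μ.colLen 0 < μ.rowLen (b - 1) := by
          rw [firstColHook] at h1
          omega
        have h3 := (μ.lt_rowLen_iff _ _).1 h2
        omega
  omega

/-- The hook length at (i, j) is the first column hook of row i minus y, where y = j + `μ.colLen 0`
- `μ.colLen j`. These y are exactly the natural numbers that are not first column hooks, so a hook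
of length s is an x in the set with x - s outside it. -/
theorem isCore_iff {μ : YoungDiagram} {s : ℕ} (hs : 0 < s) :
    μ.IsCore s ↔ ∀ x ∈ μ.firstColHooks, s ≤ x → x - s ∈ μ.firstColHooks := by
  constructor
  · intro h x hx hsx
    by_contra hy
    obtain ⟨i, hi, rfl⟩ := mem_image.1 hx
    obtain ⟨j, hj⟩ := exists_add_colLen_eq hy
    have hi' := mem_range.1 hi
    have hij := μ.lt_rowLen_iff i j
    unfold firstColHook at hj hsx
    refine h i j (mem_iff_lt_rowLen.2 ?_) ?_
    · omega
    · unfold hookLength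
      omega
  · intro h i j hij hs'
    have h1 := mem_iff_lt_rowLen.1 hij
    have h2 := mem_iff_lt_colLen.1 hij
    have h3 := μ.colLen_anti 0 j (Nat.zero_le _)
    unfold hookLength at hs'
    have hmem := h (μ.firstColHook i) (mem_image.2 ⟨i, mem_range.2 (by omega), rfl⟩)
      (by unfold firstColHook; omega)
    obtain ⟨i', hi', he⟩ := mem_image.1 hmem
    have hi' := mem_range.1 hi'
    have h4 := μ.lt_rowLen_iff i' j
    unfold firstColHook at he
    omega

/-- The first column hooks of adjacent rows differ by one plus the difference of the two parts. -/
theorem hasDistinctParts_iff {μ : YoungDiagram} :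
    μ.HasDistinctParts ↔ ∀ x ∈ μ.firstColHooks, x + 1 ∉ μ.firstColHooks := by
  have hnodup : μ.HasDistinctParts ↔
      ∀ i < μ.colLen 0, ∀ j < μ.colLen 0, μ.rowLen i = μ.rowLen j → i = j := by
    rw [HasDistinctParts, rowLens, List.nodup_map_iff_inj_on List.nodup_range]
    simp only [List.mem_range]
  rw [hnodup]
  constructor
  · intro h x hx hx'
    obtain ⟨i, hi, rfl⟩ := mem_image.1 hx
    obtain ⟨j, hj, he⟩ := mem_image.1 hx'
    have hi := mem_range.1 hi
    have hj := mem_range.1 hj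
    unfold firstColHook at he
    rcases lt_trichotomy i j with hij | rfl | hij
    · have := μ.rowLen_anti i j hij.le
      omega
    · omega
    · have := μ.rowLen_anti j i hij.le
      have := h i hi j hj (by omega)
      omega
  · intro h
    have key : ∀ i j, i < j → j < μ.colLen 0 → μ.rowLen i ≠ μ.rowLen j := by
      intro i j hij hj he
      have h1 := μ.rowLen_anti i (i + 1) (by omega)
      have h2 := μ.rowLen_anti (i + 1) j hij
      refine h (μ.firstColHook (i + 1)) (mem_image.2 ⟨i + 1, mem_range.2 (by omega), rfl⟩)
        (mem_image.2 ⟨i, mem_range.2 (by omega), ?_⟩)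
      unfold firstColHook
      omega
    intro i hi j hj he
    rcases lt_trichotomy i j with hij | hij | hij
    · exact absurd he (key i j hij hj)
    · exact hij
    · exact absurd he.symm (key j i hij hi)

theorem card_eq_sum_rowLen (μ : YoungDiagram) :
    μ.card = ∑ i ∈ range (μ.colLen 0), μ.rowLen i := by
  rw [YoungDiagram.card, card_eq_sum_card_fiberwise (f := Prod.fst) (t := range (μ.colLen 0))]
  · exact sum_congr rfl fun i _ => (μ.rowLen_eq_card (i := i)).symm
  · intro c hc
    have hc' : (c.1, c.2) ∈ μ := hc
    have := μ.colLen_anti 0 c.2 (Nat.zero_le _)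
    exact mem_coe.2 (mem_range.2 ((mem_iff_lt_colLen.1 hc').trans_le this))

/-- The first column hooks are the parts plus the staircase k-1, ..., 1, 0, where k is the number of
rows. -/
theorem two_mul_card (μ : YoungDiagram) :
    2 * (μ.card : ℤ) = 2 * ∑ x ∈ μ.firstColHooks, (x : ℤ)
      - #μ.firstColHooks * (#μ.firstColHooks - 1) := by
  rw [card_firstColHooks, firstColHooks, sum_image μ.firstColHook_injOn, card_eq_sum_rowLen]
  have h1 := sum_range_reflect (fun i => i) (μ.colLen 0)
  have h2 := sum_range_id_mul_two (μ.colLen 0)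
  rw [← h1] at h2
  simp only [firstColHook]
  push_cast [sum_add_distrib]
  have h3 : ((∑ i ∈ range (μ.colLen 0), (μ.colLen 0 - 1 - i) : ℕ) : ℤ) * 2
      = μ.colLen 0 * (μ.colLen 0 - 1) := by
    rw [← Nat.cast_two, ← Nat.cast_mul, h2]
    rcases Nat.eq_zero_or_pos (μ.colLen 0) with h0 | h0
    · simp [h0]
    · rw [Nat.cast_mul, Nat.cast_sub h0, Nat.cast_one]
  push_cast at h3
  linarith

theorem firstColHooks_injective : Function.Injective firstColHooks := by
  intro μ ν h
  have hk : μ.colLen 0 = ν.colLen 0 := by rw [← card_firstColHooks, h, card_firstColHooks]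
  have hrange : Set.range (fun i : Fin (μ.colLen 0) => μ.firstColHook i)
      = Set.range (fun i : Fin (μ.colLen 0) => ν.firstColHook i) := by
    have hr : ∀ ρ : YoungDiagram, Set.range (fun i : Fin (ρ.colLen 0) => ρ.firstColHook i)
        = ρ.firstColHooks := by
      intro ρ
      ext x
      simp only [Set.mem_range, firstColHooks, coe_image, Set.mem_image, coe_range, Set.mem_Iio]
      exact ⟨fun ⟨i, hi⟩ => ⟨i, i.2, hi⟩, fun ⟨i, hi, he⟩ => ⟨⟨i, hi⟩, he⟩⟩
    rw [hr, h, ← hr, hk]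
  have hanti : ∀ ρ : YoungDiagram, ρ.colLen 0 = μ.colLen 0 →
      StrictAnti (fun i : Fin (μ.colLen 0) => ρ.firstColHook i) :=
    fun ρ hρ i j hij => firstColHook_lt hij (by rw [hρ]; exact j.2)
  have heq := ((hanti μ rfl).range_inj (hanti ν hk.symm)).1 hrange
  have hrow : ∀ i, μ.rowLen i = ν.rowLen i := by
    intro i
    by_cases hi : i < μ.colLen 0
    · have := congrFun heq ⟨i, hi⟩
      simp only [firstColHook, hk] at this
      omega
    · have h1 := μ.lt_rowLen_iff i 0
      have h2 := ν.lt_rowLen_iff i 0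
      omega
  refine SetLike.ext fun c => ?_
  have : ∀ ρ : YoungDiagram, c ∈ ρ ↔ c.2 < ρ.rowLen c.1 := fun ρ => mem_iff_lt_rowLen
  rw [this, this, hrow]

/-- Adding a row on top leaves the first column hooks of the old rows unchanged. A new maximum a is
obtained with a row of length a minus the old number of rows. -/
theorem exists_firstColHooks_eq (S : Finset ℕ) (h0 : 0 ∉ S) : ∃ μ, firstColHooks μ = S := by
  induction S using Finset.induction_on_max with
  | empty => exact ⟨⊥, by
      rw [← card_eq_zero, card_firstColHooks]
      have := (⊥ : YoungDiagram).colLen_eq_card (j := 0)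
      rw [this, col]
      rfl⟩
  | insert a S hmax ih =>
    obtain ⟨μ, hμ⟩ := ih fun h => h0 (mem_insert_of_mem h)
    have ha0 : a ≠ 0 := by
      rintro rfl
      exact h0 (mem_insert_self _ _)
    have hlt : ∀ i < μ.colLen 0, μ.rowLen i + μ.colLen 0 ≤ a := by
      intro i hi
      have h1 := hmax (μ.firstColHook 0)
        (by rw [← hμ]; exact mem_image.2 ⟨0, mem_range.2 (by omega), rfl⟩)
      have h2 := μ.rowLen_anti 0 i (Nat.zero_le _)
      unfold firstColHook at h1
      omega
    have hpos : 0 < a - μ.colLen 0 := by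
      rcases Nat.eq_zero_or_pos (μ.colLen 0) with h | h
      · omega
      · have h1 := hlt 0 h
        have h2 := (μ.lt_rowLen_iff 0 0).2 h
        omega
    have hsorted : ((a - μ.colLen 0) :: μ.rowLens).SortedGE := by
      rw [List.sortedGE_iff_pairwise, List.pairwise_cons]
      refine ⟨fun x hx => ?_, μ.rowLens_sorted.pairwise⟩
      obtain ⟨i, hi, rfl⟩ := List.mem_map.1 hx
      have := hlt i (List.mem_range.1 hi)
      omega
    have hp : ∀ x ∈ (a - μ.colLen 0) :: μ.rowLens, 0 < x := by
      intro x hx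
      rcases List.mem_cons.1 hx with rfl | hx
      · exact hpos
      · exact μ.pos_of_mem_rowLens x hx
    set ν := ofRowLens _ hsorted with hν
    have hlen : ν.colLen 0 = μ.colLen 0 + 1 := by
      rw [← length_rowLens, hν, rowLens_length_ofRowLens hp, List.length_cons, length_rowLens]
    have hrow0 : ν.rowLen 0 = a - μ.colLen 0 :=
      rowLen_ofRowLens (w := (a - μ.colLen 0) :: μ.rowLens) (hw := hsorted) ⟨0, by simp⟩
    have hrow : ∀ i < μ.colLen 0, ν.rowLen (i + 1) = μ.rowLen i := by
      intro i hi
      have := rowLen_ofRowLens (w := (a - μ.colLen 0) :: μ.rowLens) (hw := hsorted)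
        ⟨i + 1, by rw [List.length_cons, length_rowLens]; omega⟩
      rw [hν, this]
      simp [get_rowLens]
    refine ⟨ν, ?_⟩
    rw [firstColHooks, hlen, range_add_one', image_insert, map_eq_image, image_image, ← hμ, firstColHooks]
    congr 1
    · rw [firstColHook, hrow0, hlen]
      omega
    · refine image_congr fun i hi => ?_
      have hi' := mem_range.1 (mem_coe.1 hi)
      simp only [Function.comp, firstColHook, hlen]
      change ν.rowLen (i + 1) + (μ.colLen 0 + 1 - 1 - (i + 1)) = _
      rw [hrow i hi']
      omega

end YoungDiagram

/-! ### Size of the encoded partition and conclusion. -/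

namespace SignWalk

open Finset

theorem sum_colCard {n : ℕ} {w : ℕ → ℤ} (h0 : 0 < w 0) :
    ∑ c ∈ range (2 * n + 2), colCard c (w c) = absSum n w + evenSign n w - 1 := by
  have h1 := sum_range_two_mul_even (fun c => (w c).sign) (n + 1)
  rw [sum_range_succ', mul_zero, Int.sign_eq_one_of_pos h0] at h1
  have h2 : ∑ c ∈ range (2 * n + 2), (if c = 0 then (2 : ℤ) else 0) = 2 := by simp
  simp only [colCard]
  rw [show 2 * (n + 1) = 2 * n + 2 by ring] at h1
  rw [sum_sub_distrib, sum_add_distrib, h2, h1, absSum, evenSign]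
  ring

theorem sum_colSum {n : ℕ} {w : ℕ → ℤ} (h0 : 0 < w 0) :
    ∑ c ∈ range (2 * n + 2), colSum n c (w c) = (n + 1) * sqSum n w + absMoment n w - absSum n w
      + evenSignMoment n w - evenSign n w - n := by
  have h1 := sum_range_two_mul_even
    (fun c => ((c : ℤ) - (n + 1) - 1) * (w c).sign) (n + 1)
  rw [sum_range_succ', mul_zero, Int.sign_eq_one_of_pos h0] at h1
  have h2 : ∑ c ∈ range (2 * n + 2), (if c = 0 then (2 : ℤ) else 0) = 2 := by simp
  have h3 : ∑ k ∈ range n, (((2 * (k + 1) : ℕ) : ℤ) - (n + 1) - 1) * (w (2 * (k + 1))).sign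
      = evenSignMoment n w - evenSign n w := by
    rw [evenSignMoment, evenSign, ← sum_sub_distrib]
    exact sum_congr rfl fun k _ => by push_cast; ring
  rw [h3] at h1
  have h4 : (n + 1) * sqSum n w + absMoment n w - absSum n w
      = ∑ c ∈ range (2 * n + 2), ((n + 1) * w c ^ 2 + ((c : ℤ) - (n + 1)) * |w c|
        + (n + 1) * w c - |w c|) := by
    rw [sqSum, absMoment, absSum, mul_sum, ← sum_add_distrib, ← sum_sub_distrib]
    exact sum_congr rfl fun c _ => by ring
  rw [h4]
  simp only [colSum]
  rw [sum_add_distrib (g := fun c => if c = 0 then (2 : ℤ) else 0), sum_add_distrib, h2,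
    show 2 * n + 2 = 2 * (n + 1) by ring, h1]
  push_cast
  ring

theorem isGood_walk {n : ℕ} {E : Finset ℕ} (hE : E ∈ good n) : IsGood n (walk n E) := by
  obtain ⟨h1, h2, h3⟩ := mem_filter.1 hE
  exact ⟨isWalk_walk (mem_powerset.1 h1), Int.odd_iff.1 h2, h3⟩

/-- The size of a core partition in terms of the walk encoding it. -/
theorem IsGood.sizeStat_eq {n : ℕ} {w : ℕ → ℤ} (hw : IsGood n w) {S : Finset ℕ}
    (hS : ∀ x, x ∈ S ↔ InCode n w x) :
    sizeStat n w = 8 * ∑ x ∈ S, (x : ℤ) - 4 * (#S * (#S - 1)) := by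
  -- The cardinality and sum formulas are known only for the walk built inductively from S;
  -- uniqueness of the encoding transfers them to w.
  obtain ⟨w', hw', he⟩ := (hw.isDistinctCode hS).exists_encodes n S
  have hww := hw.eq_of_inCode_iff hw' fun x => (hS x).symm.trans (he.mem_iff x)
  have h1 := he.card_eq
  have h2 := he.sum_eq
  rw [sum_colCard hw'.pos_zero, ← absSum_congr hww, ← evenSign_congr hww] at h1
  rw [sum_colSum hw'.pos_zero, ← absSum_congr hww, ← evenSign_congr hww, ← sqSum_congr hww,
    ← absMoment_congr hww, ← evenSignMoment_congr hww] at h2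
  rw [sizeStat]
  linear_combination (-4) * h2 + (2 * (#S : ℤ) + (absSum n w + evenSign n w - 1) - 2) * h1

end SignWalk

open Finset SignWalk YoungDiagram in
theorem mem_distinctCores_iff {n : ℕ} {μ : YoungDiagram} :
    μ ∈ distinctCores (2 * n + 1) (2 * n + 3) ↔ IsDistinctCode n μ.firstColHooks := by
  have : μ ∈ distinctCores (2 * n + 1) (2 * n + 3) ↔
    μ.IsCore (2 * n + 1) ∧ μ.IsCore (2 * n + 3) ∧ μ.HasDistinctParts := Iff.rfl
  rw [this, isCore_iff (by omega), isCore_iff (by omega), hasDistinctParts_iff]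
  exact ⟨fun ⟨h1, h2, h3⟩ => ⟨μ.zero_notMem_firstColHooks, h3, h1, h2⟩,
    fun h => ⟨h.sub_mem, h.sub_mem', h.succ_notMem⟩⟩

open Finset SignWalk YoungDiagram in
/-- The walks with odd positive starting value parametrize the cores with distinct parts. -/
theorem exists_parametrization (n : ℕ) : ∃ Φ : Finset ℕ → YoungDiagram,
    Set.InjOn Φ (good n) ∧ Φ '' (good n) = distinctCores (2 * n + 1) (2 * n + 3) ∧
      ∀ E ∈ good n, 8 * ((Φ E).card : ℤ) = sizeStat n (walk n E) := by
  have hex : ∀ E, ∃ μ : YoungDiagram, E ∈ good n →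
      ∀ x, x ∈ μ.firstColHooks ↔ InCode n (walk n E) x := by
    intro E
    by_cases hE : E ∈ good n
    · obtain ⟨S, hS⟩ := exists_code (n := n) (walk n E)
      obtain ⟨μ, rfl⟩ := exists_firstColHooks_eq S ((isGood_walk hE).isDistinctCode hS).zero_notMem
      exact ⟨μ, fun _ => hS⟩
    · exact ⟨⊥, fun h => absurd h hE⟩
  choose Φ hΦ using hex
  refine ⟨Φ, fun E hE E' hE' h => ?_, Set.eq_of_subset_of_subset ?_ fun μ hμ => ?_, fun E hE => ?_⟩
  · have hE := mem_coe.1 hE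
    have hE' := mem_coe.1 hE'
    have heq := (isGood_walk hE).eq_of_inCode_iff (isGood_walk hE') fun x => by
      rw [← hΦ E hE, h, hΦ E' hE']
    rw [← upSteps_walk (mem_powerset.1 (mem_filter.1 hE).1), upSteps_congr heq,
      upSteps_walk (mem_powerset.1 (mem_filter.1 hE').1)]
  · rintro _ ⟨E, hE, rfl⟩
    exact mem_distinctCores_iff.2 ((isGood_walk hE).isDistinctCode (hΦ E hE))
  · obtain ⟨w, hw, he⟩ := (mem_distinctCores_iff.1 hμ).exists_encodes n _
    have hwalk : ∀ c ≤ 2 * n + 2, walk n (upSteps n w) c = w c := fun c hc =>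
      walk_upSteps hw.toIsWalk hc
    have hgood : upSteps n w ∈ good n := by
      rw [good, mem_filter, hwalk 0 (by omega), Int.odd_iff]
      exact ⟨mem_powerset.2 (upSteps_subset _ _), hw.odd_zero, hw.pos_zero⟩
    refine ⟨upSteps n w, hgood, firstColHooks_injective (Finset.ext fun x => ?_)⟩
    obtain ⟨q, c, hc, hqc⟩ := exists_coords n x
    rw [hΦ _ hgood, he.mem_iff, inCode_iff _ hc hqc, inCode_iff _ hc hqc, Below, Below,
      hwalk c hc.le]
  · rw [(isGood_walk hE).sizeStat_eq (hΦ E hE)]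
    have := two_mul_card (Φ E)
    linarith

open SignWalk in
theorem theorem1 (n : ℕ) :
    ∃ hfin : (distinctCores (2 * n + 1) (2 * n + 3)).Finite,
      hfin.toFinset.card = 4 ^ n ∧
      (∑ μ ∈ hfin.toFinset, (μ.card : ℚ)) / (hfin.toFinset.card : ℚ)
        = (10 * (n : ℚ) ^ 3 + 27 * (n : ℚ) ^ 2 + 19 * (n : ℚ)) / 32 := by
  classical
  obtain ⟨Φ, hinj, himg, hsize⟩ := exists_parametrization n
  have hfin : (distinctCores (2 * n + 1) (2 * n + 3)).Finite := by
    rw [← himg]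
    exact (good n).finite_toSet.image Φ
  have hF : hfin.toFinset = (good n).image Φ := by
    apply Finset.coe_injective
    rw [Set.Finite.coe_toFinset, Finset.coe_image, himg]
  have hcard : hfin.toFinset.card = 4 ^ n := by
    rw [hF, Finset.card_image_of_injOn hinj, card_good]
  refine ⟨hfin, hcard, ?_⟩
  have hsum : (32 : ℤ) * ∑ μ ∈ hfin.toFinset, (μ.card : ℤ)
      = 4 ^ n * (10 * (n : ℤ) ^ 3 + 27 * n ^ 2 + 19 * n) := by
    rw [← sum_good_sizeStat, hF, Finset.sum_image hinj, ← Finset.sum_congr rfl hsize,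
      ← Finset.mul_sum]
    ring
  have hsumQ : (32 : ℚ) * ∑ μ ∈ hfin.toFinset, (μ.card : ℚ)
      = 4 ^ n * (10 * (n : ℚ) ^ 3 + 27 * n ^ 2 + 19 * n) := by exact_mod_cast hsum
  rw [hcard]
  push_cast
  rw [div_eq_div_iff (by positivity) (by norm_num)]
  linarith
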